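/- Let $\mathcal X\subset\mathbb R$ be a Borel set (for instance an interval) with the metric $d(x,y)=|x-y|$, let $f:\mathcal X\to\mathcal X$ be measurable, and let $\mu$ be an $f$-invariant ergodic probability measure on $\mathcal X$ that is absolutely continuous with respect to Lebesgue measure, $d\mu=\rho\,dx$. For $\varphi:\mathcal X\to\mathbb R$ put $\|\varphi\|_{\mathrm{BV}}=\mathrm{var}_{\mathcal X}(\varphi)+\sup_{\mathcal X}|\varphi|$, where $\mathrm{var}_{\mathcal X}$ is the total variation on $\mathcal X$, and write $\varphi\in\mathrm{BV}$ if this is finite. Suppose that $(\mathcal X,f,\mu)$ is hyperbolic recurrent, that is, $\rho\in\mathrm{BV}$ and: (A1) there are $C,\theta>0$ such that for all $\varphi_1\in\mathrm{BV}$, $\varphi_2\in L^1(\mu)$ and $j\ge 0$, $$\left|\int\varphi_1\cdot\varphi_2\circ f^j\,d\mu-\int\varphi_1\,d\mu\int\varphi_2\,d\mu\right|\le Ce^{-\theta j}\,\|\varphi_1\|_{\mathrm{BV}}\,\|\varphi_2\|_{L^1(\mu)};$$ (A2) for every $a>0$ and every sequence $(r_n)$ such that, for some $c>1$, $c^{-1}\le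 r_n/n^{-a}\le c$ for all large $n$, there are $\beta_0\in(0,1)$ and $C>0$ such that for all sufficiently large $n$ and all integers $1\le j\le(\log n)^2$, $$\mu\{x\in\mathcal X: d(x,f^jx)\le r_n\}\le C\,r_n^{\beta_0}.$$ Let $\tau>0$, $r_n=\tau/(2n)$ and $R_n(r,x)=\#\{1\le j\le n: d(f^jx,x)\le r\}$. Then for every integer $k\ge1$, $$\lim_{n\to\infty}\mu\{x\in\mathcal X: R_n(r_n,x)=k\}=\int_{\mathcal X}\frac{\tau^k\rho(x)^{k+1}}{k!}e^{-\rho(x)\tau}\,dx.$$ -/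

import Mathlib

open MeasureTheory Filter Topology
open scoped ENNReal

noncomputable section

/-- The `BV` norm `var φ + sup |φ|` of a function on a subset `X` of the line, with values in
`[0, ∞]`; both terms are pointwise (no almost-everywhere identification). -/
def bvNorm {X : Set ℝ} (φ : X → ℝ) : ℝ≥0∞ :=
  eVariationOn φ Set.univ + ⨆ x, ‖φ x‖ₑ

/-- Functions of bounded variation: those with finite `BV` norm. -/
def IsBV {X : Set ℝ} (φ : X → ℝ) : Prop :=
  bvNorm φ < ∞

/-- The correlation `|∫ φ₁ · φ₂ ∘ f^j dμ - ∫ φ₁ dμ ∫ φ₂ dμ|`. -/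
def correlation {X : Set ℝ} (f : X → X) (μ : Measure X) (j : ℕ) (φ₁ φ₂ : X → ℝ) : ℝ :=
  |(∫ x, φ₁ x * φ₂ (f^[j] x) ∂μ) - (∫ x, φ₁ x ∂μ) * (∫ x, φ₂ x ∂μ)|

/-- Decay of correlations in `BV` versus `L¹(μ)` with rate function `Θ`. -/
def HasDecayOfCorrelations {X : Set ℝ} (f : X → X) (μ : Measure X) (Θ : ℕ → ℝ) : Prop :=
  Tendsto Θ atTop (𝓝 0) ∧
    ∀ φ₁ φ₂ : X → ℝ, IsBV φ₁ → Integrable φ₂ μ → ∀ j : ℕ,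
      correlation f μ j φ₁ φ₂ ≤ Θ j * (bvNorm φ₁).toReal * ∫ x, |φ₂ x| ∂μ

/-- Exponential decay of correlations in `BV` versus `L¹(μ)`. -/
def HasExponentialDecay {X : Set ℝ} (f : X → X) (μ : Measure X) : Prop :=
  ∃ C > 0, ∃ θ > 0, HasDecayOfCorrelations f μ (fun j => C * Real.exp (-θ * j))

/-- The set `E_j(r)` of points with `d(x, f^j x) ≤ r`. -/
def closeReturnSet {X : Set ℝ} (f : X → X) (j : ℕ) (r : ℝ) : Set X :=
  {x | dist x (f^[j] x) ≤ r}

/-- `a_n ≈ b_n`: the ratio `a_n / b_n` is in `[c⁻¹, c]` for some `c > 1` and all large `n`. -/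
def SeqComparable (a b : ℕ → ℝ) : Prop :=
  ∃ c > 1, ∀ᶠ n in atTop, a n / b n ∈ Set.Icc c⁻¹ c

/-- The short-return bound: along every sequence `r_n ≈ n^(-a)`, `a > 0`, the sets `E_j(r_n)`
with `1 ≤ j ≤ (log n)²` have measure at most `C r_n^β`, for some `β ∈ (0,1)` and `C > 0` that do
not depend on `j` and `n`. -/
def ShortReturnBound {X : Set ℝ} (f : X → X) (μ : Measure X) : Prop :=
  ∀ (a : ℝ) (r : ℕ → ℝ), 0 < a → SeqComparable r (fun n => (n : ℝ) ^ (-a)) →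
    ∃ β ∈ Set.Ioo (0 : ℝ) 1, ∃ C > 0, ∀ᶠ n : ℕ in atTop, ∀ j : ℕ, 1 ≤ j →
      (j : ℝ) ≤ Real.log n ^ 2 → μ.real (closeReturnSet f j (r n)) ≤ C * r n ^ β

/-- Lebesgue measure on a (measurable) subset `X` of the line: `A ↦ Leb(A)` for `A ⊆ X`. -/
def lebesgueOn (X : Set ℝ) : Measure X :=
  (volume : Measure ℝ).comap Subtype.val

/-- `ρ` is a density of `μ` with respect to Lebesgue measure on `X`. -/
structure IsLebesgueDensity {X : Set ℝ} (μ : Measure X) (ρ : X → ℝ) : Prop where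
  measurable : Measurable ρ
  nonneg : ∀ x, 0 ≤ ρ x
  eq_withDensity : μ = (lebesgueOn X).withDensity (fun x => ENNReal.ofReal (ρ x))

/-- A hyperbolic recurrent system `(X, f, μ)` with invariant density `ρ`. Mathlib's `Ergodic`
contains that `f` is measurable and preserves `μ`. -/
structure HyperbolicRecurrent {X : Set ℝ} (f : X → X) (μ : Measure X) (ρ : X → ℝ) : Prop where
  isProbabilityMeasure : IsProbabilityMeasure μ
  ergodic : Ergodic f μ
  density : IsLebesgueDensity μ ρ
  density_bv : IsBV ρ
  decay : HasExponentialDecay f μ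
  shortReturns : ShortReturnBound f μ

/-- `R_n(r, x)`, the number of `1 ≤ j ≤ n` with `d(f^j x, x) ≤ r`. -/
def recurrenceCount {X : Set ℝ} (f : X → X) (n : ℕ) (r : ℝ) (x : X) : ℕ :=
  ((Finset.Icc 1 n).filter (fun j => dist (f^[j] x) x ≤ r)).card

end

/-!
Let `g = g(n)` be about `(log n)²`. By the short-return bound, returns at times before `g` have
total probability tending to zero. For later times, a return to within `τ / (2n)` of the starting
point is sandwiched between two events saying that the orbit comes back to a window of cells
centred at the cell of the starting point. Once the starting cell is fixed, such an event is a
finite intersection of preimages of intervals, whose indicators have bounded `BV` norm, so decay of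
correlations makes returns at `g`-separated times independent conditionally on the starting cell.
By Lebesgue differentiation the expected number of such `m`-tuples of return times converges to
`∫ (τ ρ)^m / m! dμ`. Two returns less than `g` apart force the orbit to be at a point with a short
return, which again is rare. Hence all factorial moments of the number of returns converge to those
of a Poisson variable with the random parameter `τ ρ`, and the Bonferroni inequalities turn this
into convergence of the probabilities.
-/

/-- A finite set of times any two of which are at distance at least `g`. -/
def SeparatedBy (g : ℕ) (s : Finset ℕ) : Prop :=
  ∀ i ∈ s, ∀ j ∈ s, i < j → i + g ≤ j

/-- The set `A` decorrelates from every event that happens at least `g` steps later, with an error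
`η` relative to the measure of that later event. -/
def DecorrelatesAfter {Ω : Type*} [MeasurableSpace Ω] (f : Ω → Ω) (μ : Measure Ω) (g : ℕ) (η : ℝ)
    (A : Set Ω) : Prop :=
  ∀ W : Set Ω, MeasurableSet W → ∀ j : ℕ, g ≤ j →
    |μ.real (A ∩ f^[j] ⁻¹' W) - μ.real A * μ.real W| ≤ η * μ.real W

lemma biInter_preimage_iterate_eq_preimage {Ω : Type*} {f : Ω → Ω} {A : Set Ω} {a : ℕ}
    {s : Finset ℕ} (hs : ∀ j ∈ s, a ≤ j) :
    ⋂ j ∈ s, f^[j] ⁻¹' A = f^[a] ⁻¹' ⋂ i ∈ s.image (· - a), f^[i] ⁻¹' A := by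
  ext x
  simp only [Set.mem_iInter, Set.mem_preimage, Finset.mem_image, forall_exists_index, and_imp,
    forall_apply_eq_imp_iff₂]
  refine forall₂_congr fun j hj => ?_
  rw [← Function.iterate_add_apply, Nat.sub_add_cancel (hs j hj)]

section Mixing

variable {Ω : Type*} [MeasurableSpace Ω] {f : Ω → Ω} {μ : Measure Ω} {g : ℕ} {η : ℝ}

lemma SeparatedBy.mono {s t : Finset ℕ} (h : SeparatedBy g t) (hst : s ⊆ t) : SeparatedBy g s :=
  fun i hi j hj => h i (hst hi) j (hst hj)

lemma measurableSet_biInter_preimage_iterate (hf : Measurable f) {A : Set Ω}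
    (hA : MeasurableSet A) (s : Finset ℕ) : MeasurableSet (⋂ j ∈ s, f^[j] ⁻¹' A) :=
  s.measurableSet_biInter fun j _ => hf.iterate j hA

lemma DecorrelatesAfter.abs_measureReal_inter_biInter_sub_le (hf : MeasurePreserving f μ μ)
    {A J : Set Ω} (hA : MeasurableSet A) (hJ : MeasurableSet J) (hmix : DecorrelatesAfter f μ g η J)
    {a : ℕ} {s : Finset ℕ} (hs : ∀ j ∈ s, a + g ≤ j) :
    |μ.real (f^[a] ⁻¹' J ∩ ⋂ j ∈ s, f^[j] ⁻¹' A) - μ.real J * μ.real (⋂ j ∈ s, f^[j] ⁻¹' A)|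
      ≤ η * μ.real (⋂ j ∈ s, f^[j] ⁻¹' A) := by
  set W := ⋂ i ∈ s.image (· - (a + g)), f^[i] ⁻¹' A
  have hW : MeasurableSet W := measurableSet_biInter_preimage_iterate hf.measurable hA _
  have hshift : ⋂ j ∈ s, f^[j] ⁻¹' A = f^[a] ⁻¹' (f^[g] ⁻¹' W) := by
    rw [biInter_preimage_iterate_eq_preimage hs, ← Set.preimage_comp, ← Function.iterate_add,
      add_comm g]
  have hgW : MeasurableSet (f^[g] ⁻¹' W) := hf.measurable.iterate g hW
  rw [hshift, ← Set.preimage_inter,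
    (hf.iterate a).measureReal_preimage (hJ.inter hgW).nullMeasurableSet,
    (hf.iterate a).measureReal_preimage hgW.nullMeasurableSet,
    (hf.iterate g).measureReal_preimage hW.nullMeasurableSet]
  exact hmix W hW g le_rfl

variable [IsProbabilityMeasure μ]

lemma measureReal_biInter_preimage_iterate_le (hf : MeasurePreserving f μ μ) {A : Set Ω}
    (hA : MeasurableSet A) {s : Finset ℕ} (hs : s.Nonempty) :
    μ.real (⋂ j ∈ s, f^[j] ⁻¹' A) ≤ μ.real A := by
  obtain ⟨j, hj⟩ := hs
  rw [← (hf.iterate j).measureReal_preimage hA.nullMeasurableSet]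
  exact measureReal_mono (Set.biInter_subset_of_mem hj)

lemma DecorrelatesAfter.abs_measureReal_inter_biInter_sub_mul_pow_le (hf : MeasurePreserving f μ μ)
    {A : Set Ω} (hA : MeasurableSet A) (hmixA : DecorrelatesAfter f μ g η A) (hη : 0 ≤ η)
    {s : Finset ℕ} (hsep : SeparatedBy g s) {J : Set Ω} (hJ : MeasurableSet J)
    (hmixJ : DecorrelatesAfter f μ g η J) {a : ℕ} (has : ∀ j ∈ s, a + g ≤ j) :
    |μ.real (f^[a] ⁻¹' J ∩ ⋂ j ∈ s, f^[j] ⁻¹' A) - μ.real J * μ.real A ^ s.card|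
      ≤ s.card * (η * μ.real A) := by
  induction s using Finset.induction_on_min generalizing J a with
  | empty => simp [(hf.iterate a).measureReal_preimage hJ.nullMeasurableSet]
  | insert b s hb ih =>
    have hsplit : ⋂ j ∈ insert b s, f^[j] ⁻¹' A = f^[b] ⁻¹' A ∩ ⋂ j ∈ s, f^[j] ⁻¹' A :=
      Finset.set_biInter_insert ..
    have hfirst := hmixJ.abs_measureReal_inter_biInter_sub_le hf hA hJ has
    have hrest := ih (hsep.mono (Finset.subset_insert b s)) hA hmixA fun j hj =>
      hsep b (by simp) j (by simp [hj]) (hb j hj)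
    have hle := measureReal_biInter_preimage_iterate_le hf hA (s.insert_nonempty b)
    rw [← hsplit] at hrest
    rw [Finset.card_insert_of_notMem fun h => (hb b h).false, pow_succ']
    set q := μ.real (⋂ j ∈ insert b s, f^[j] ⁻¹' A)
    set Q := μ.real (f^[a] ⁻¹' J ∩ ⋂ j ∈ insert b s, f^[j] ⁻¹' A)
    set p := μ.real A
    calc |Q - μ.real J * (p * p ^ s.card)|
        = |(Q - μ.real J * q) + μ.real J * (q - p * p ^ s.card)| := by ring_nf
      _ ≤ |Q - μ.real J * q| + μ.real J * |q - p * p ^ s.card| := by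
          refine (abs_add_le _ _).trans_eq ?_
          rw [abs_mul, abs_of_nonneg measureReal_nonneg]
      _ ≤ η * p + 1 * (s.card * (η * p)) := by
          gcongr
          · exact hfirst.trans (by gcongr)
          · exact measureReal_le_one
      _ = (s.card + 1 : ℕ) * (η * p) := by push_cast; ring

end Mixing

/-- The union of the `2w + 1` level sets of `κ` that are centred at the value `a`. The level sets
play the role of cells of a partition of the space. -/
def cellWindow {Ω : Type*} (κ : Ω → ℤ) (w : ℕ) (a : ℤ) : Set Ω :=
  κ ⁻¹' Set.Icc (a - w) (a + w)

section Cells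

variable {Ω : Type*} [MeasurableSpace Ω] {f : Ω → Ω} {μ : Measure Ω} {g : ℕ} {η : ℝ} {κ : Ω → ℤ}

lemma measurableSet_cellWindow (hκ : Measurable κ) (w : ℕ) (a : ℤ) :
    MeasurableSet (cellWindow κ w a) :=
  hκ measurableSet_Icc

lemma hasSum_measureReal_preimage_singleton_mul {ι : Type*} [Countable ι] [MeasurableSpace ι]
    [MeasurableSingletonClass ι] {κ : Ω → ι} (hκ : Measurable κ) {c : ι → ℝ}
    (hc : Integrable (fun x => c (κ x)) μ) :
    HasSum (fun a => μ.real (κ ⁻¹' {a}) * c a) (∫ x, c (κ x) ∂μ) := by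
  have hcell (a : ι) : MeasurableSet (κ ⁻¹' {a}) := hκ (measurableSet_singleton a)
  have hdisj : Pairwise (Function.onFun Disjoint fun a => κ ⁻¹' {a}) := pairwise_disjoint_fiber κ
  have hsum := hasSum_integral_iUnion hcell hdisj hc.integrableOn
  rw [← Set.preimage_iUnion, Set.iUnion_of_singleton, Set.preimage_univ, setIntegral_univ] at hsum
  refine hsum.congr_fun fun a => ?_
  rw [setIntegral_congr_fun (hcell a) fun x (hx : κ x = a) => congrArg c hx, setIntegral_const,
    smul_eq_mul]

lemma hasSum_measureReal_preimage_singleton [IsFiniteMeasure μ] {ι : Type*} [Countable ι]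
    [MeasurableSpace ι] [MeasurableSingletonClass ι] {κ : Ω → ι} (hκ : Measurable κ) :
    HasSum (fun a => μ.real (κ ⁻¹' {a})) (μ.real Set.univ) := by
  simpa using hasSum_measureReal_preimage_singleton_mul (μ := μ) hκ (c := fun _ => 1)
    (integrable_const 1)

lemma hasSum_measureReal_cellWindow [IsFiniteMeasure μ] (hκ : Measurable κ) (w : ℕ) :
    HasSum (fun a => μ.real (cellWindow κ w a)) ((2 * w + 1) * μ.real Set.univ) := by
  have hcell (a : ℤ) : μ.real (cellWindow κ w a)
      = ∑ b ∈ Finset.Icc (-(w : ℤ)) w, μ.real (κ ⁻¹' {a + b}) := by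
    have hIcc : Set.Icc (a - w) (a + w) =
        ↑((Finset.Icc (-(w : ℤ)) w).map (addLeftEmbedding a)) := by
      rw [Finset.map_add_left_Icc, Finset.coe_Icc, sub_eq_add_neg]
    rw [cellWindow, hIcc, ← sum_measureReal_preimage_singleton _
      fun b _ => hκ (measurableSet_singleton b), Finset.sum_map]
    rfl
  have hsum := hasSum_sum fun (b : ℤ) (_ : b ∈ Finset.Icc (-(w : ℤ)) w) =>
    (Equiv.addRight b).hasSum_iff.2 (hasSum_measureReal_preimage_singleton (μ := μ) hκ)
  rw [Finset.sum_const, Int.card_Icc, nsmul_eq_mul,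
    show ((w : ℤ) + 1 - -(w : ℤ)).toNat = 2 * w + 1 by omega] at hsum
  push_cast at hsum
  exact hsum.congr_fun hcell

variable [IsProbabilityMeasure μ]

lemma abs_measureReal_forall_mem_cellWindow_sub_integral_le (hf : MeasurePreserving f μ μ)
    (hκ : Measurable κ) (hη : 0 ≤ η)
    (hmix : ∀ a b : ℤ, DecorrelatesAfter f μ g η (κ ⁻¹' Set.Icc a b)) {s : Finset ℕ}
    (hsep : SeparatedBy g s) (hs : ∀ j ∈ s, g ≤ j) (w : ℕ) :
    |μ.real {x | ∀ j ∈ s, f^[j] x ∈ cellWindow κ w (κ x)}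
      - ∫ x, μ.real (cellWindow κ w (κ x)) ^ s.card ∂μ| ≤ s.card * η * (2 * w + 1) := by
  set E : Set Ω := {x | ∀ j ∈ s, f^[j] x ∈ cellWindow κ w (κ x)}
  have hcell (a : ℤ) : κ ⁻¹' {a} ∩ E
      = f^[0] ⁻¹' (κ ⁻¹' {a}) ∩ ⋂ j ∈ s, f^[j] ⁻¹' cellWindow κ w a := by
    ext x
    simp only [E, Set.mem_inter_iff, Set.mem_preimage, Set.mem_singleton_iff, Set.mem_ofPred_eq,
      Set.mem_iInter, Function.iterate_zero, id_eq, and_congr_right_iff]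
    rintro rfl
    rfl
  have hint : Integrable (fun x => μ.real (cellWindow κ w (κ x)) ^ s.card) μ := by
    have hmeas := measurable_from_top (f := fun a : ℤ => μ.real (cellWindow κ w a) ^ s.card)
    refine .of_bound (hmeas.comp hκ).aestronglyMeasurable 1 (ae_of_all _ fun x => ?_)
    rw [Real.norm_of_nonneg (by positivity)]
    exact pow_le_one₀ measureReal_nonneg measureReal_le_one
  have hE := hasSum_measureReal_preimage_singleton (μ := μ.restrict E) hκ
  have hI := hasSum_measureReal_preimage_singleton_mul hκ
    (c := fun a => μ.real (cellWindow κ w a) ^ s.card) hint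
  have hbound := (hasSum_measureReal_cellWindow (μ := μ) hκ w).mul_left (s.card * η)
  rw [measureReal_restrict_apply .univ, Set.univ_inter] at hE
  rw [probReal_univ, mul_one] at hbound
  refine (hE.sub hI).norm_le_of_bounded hbound fun a => ?_
  have hcellm : MeasurableSet (κ ⁻¹' {a}) := hκ (measurableSet_singleton a)
  rw [measureReal_restrict_apply hcellm, hcell, Real.norm_eq_abs, mul_assoc]
  refine (hmix _ _).abs_measureReal_inter_biInter_sub_mul_pow_le hf
    (measurableSet_cellWindow hκ w a) hη hsep hcellm ?_ (by simpa using hs)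
  simpa using hmix a a

lemma measureReal_mem_cellWindow_inter_le (hκ : Measurable κ)
    (hmix : ∀ a : ℤ, DecorrelatesAfter f μ g η (κ ⁻¹' {a})) {P : ℝ}
    (hP : ∀ a : ℤ, μ.real (κ ⁻¹' {a}) ≤ P) {j : ℕ} (hj : g ≤ j) (w : ℕ) {D : Set Ω}
    (hD : MeasurableSet D) :
    μ.real ({x | f^[j] x ∈ cellWindow κ w (κ x)} ∩ f^[j] ⁻¹' D)
      ≤ (P + η) * ((2 * w + 1) * μ.real D) := by
  set E : Set Ω := {x | f^[j] x ∈ cellWindow κ w (κ x)} ∩ f^[j] ⁻¹' D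
  have hcell (a : ℤ) : κ ⁻¹' {a} ∩ E = κ ⁻¹' {a} ∩ f^[j] ⁻¹' (cellWindow κ w a ∩ D) := by
    ext x
    simp only [E, Set.mem_inter_iff, Set.mem_preimage, Set.mem_singleton_iff, Set.mem_ofPred_eq,
      and_congr_right_iff]
    rintro rfl
    rfl
  have hE := hasSum_measureReal_preimage_singleton (μ := μ.restrict E) hκ
  have hbound := (hasSum_measureReal_cellWindow (μ := μ.restrict D) hκ w).mul_left (P + η)
  rw [measureReal_restrict_apply .univ, Set.univ_inter] at hE hbound
  refine hasSum_le (fun a => ?_) hE hbound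
  have hA := measurableSet_cellWindow hκ w a
  rw [measureReal_restrict_apply (hκ (measurableSet_singleton a)), measureReal_restrict_apply hA,
    hcell]
  have hcorr := (abs_le.1 (hmix a _ (hA.inter hD) j hj)).2
  have hprod := mul_le_mul_of_nonneg_right (hP a)
    (measureReal_nonneg (μ := μ) (s := cellWindow κ w a ∩ D))
  linarith

end Cells

section BoundedVariation

lemma eVariationOn_sub_le {α E : Type*} [LinearOrder α] [SeminormedAddCommGroup E] (u v : α → E)
    (s : Set α) : eVariationOn (u - v) s ≤ eVariationOn u s + eVariationOn v s := by
  refine iSup_le fun p => ?_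
  calc ∑ i ∈ Finset.range p.1, edist ((u - v) (p.2.1 (i + 1))) ((u - v) (p.2.1 i))
      ≤ ∑ i ∈ Finset.range p.1, (edist (u (p.2.1 (i + 1))) (u (p.2.1 i))
          + edist (v (p.2.1 (i + 1))) (v (p.2.1 i))) := by
        gcongr
        simp only [Pi.sub_apply, edist_eq_enorm_sub, sub_sub_sub_comm _ (v _)]
        exact enorm_sub_le
    _ ≤ eVariationOn u s + eVariationOn v s := by
        rw [Finset.sum_add_distrib]
        exact add_le_add (eVariationOn.sum_le p.2.2.1 p.2.2.2)
          (eVariationOn.sum_le p.2.2.1 p.2.2.2)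

lemma eVariationOn_indicator_le_one_of_isUpperSet {α : Type*} [LinearOrder α] {s : Set α}
    (hs : IsUpperSet s) : eVariationOn (s.indicator (1 : α → ℝ)) Set.univ ≤ 1 := by
  have hmono : Monotone (s.indicator (1 : α → ℝ)) := fun x y hxy => by
    by_cases hx : x ∈ s
    · simp [hx, hs hxy hx]
    · rw [Set.indicator_of_notMem hx]
      exact Set.indicator_nonneg (fun _ _ => zero_le_one) y
  rw [eVariationOn.eq_biSup_inter_Icc]
  refine iSup₂_le fun p hp => ?_
  rw [(hmono.monotoneOn _).eVariationOn_eq hp.1 hp.2.1, ← ENNReal.ofReal_one]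
  refine ENNReal.ofReal_le_ofReal ?_
  by_cases hx : p.1 ∈ s <;> by_cases hy : p.2 ∈ s <;> simp [hx, hy]

lemma eVariationOn_indicator_le_two_of_ordConnected {α : Type*} [LinearOrder α] {s : Set α}
    (hs : s.OrdConnected) : eVariationOn (s.indicator (1 : α → ℝ)) Set.univ ≤ 2 := by
  have hupper : IsUpperSet ((upperClosure s : Set α) \ lowerClosure s) :=
    (upperClosure s).upper.inter (lowerClosure s).lower.compl
  have hdiff : s.indicator (1 : α → ℝ) = (upperClosure s : Set α).indicator 1
      - ((upperClosure s : Set α) \ lowerClosure s).indicator 1 := by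
    rw [← Set.indicator_sdiff Set.sdiff_subset, sdiff_sdiff_right_self]
    exact congrArg (Set.indicator · 1) hs.upperClosure_inter_lowerClosure.symm
  calc eVariationOn (s.indicator (1 : α → ℝ)) Set.univ
      ≤ 1 + 1 := by
        rw [hdiff]
        exact (eVariationOn_sub_le _ _ _).trans (add_le_add
          (eVariationOn_indicator_le_one_of_isUpperSet (upperClosure s).upper)
          (eVariationOn_indicator_le_one_of_isUpperSet hupper))
    _ = 2 := one_add_one_eq_two

lemma bvNorm_indicator_le_three {X : Set ℝ} {s : Set X} (hs : s.OrdConnected) :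
    bvNorm (s.indicator (1 : X → ℝ)) ≤ 3 := by
  have hsup : ⨆ x, ‖s.indicator (1 : X → ℝ) x‖ₑ ≤ 1 := iSup_le fun x => by
    by_cases hx : x ∈ s <;> simp [hx]
  calc bvNorm (s.indicator (1 : X → ℝ)) ≤ 2 + 1 :=
        add_le_add (eVariationOn_indicator_le_two_of_ordConnected hs) hsup
    _ = 3 := by norm_num

lemma IsBV.exists_le {X : Set ℝ} {φ : X → ℝ} (h : IsBV φ) : ∃ K : NNReal, ∀ x, φ x ≤ K := by
  have hsup : ⨆ x, ‖φ x‖ₑ ≠ ∞ := (le_add_self.trans_lt h).ne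
  refine ⟨(⨆ x, ‖φ x‖ₑ).toNNReal, fun x => ?_⟩
  calc φ x ≤ ‖φ x‖ := Real.le_norm_self _
    _ = ‖φ x‖ₑ.toReal := (toReal_enorm _).symm
    _ ≤ (⨆ x, ‖φ x‖ₑ).toReal := ENNReal.toReal_mono hsup (le_iSup (fun x => ‖φ x‖ₑ) x)

lemma HasDecayOfCorrelations.decorrelatesAfter {X : Set ℝ} {f : X → X} {μ : Measure X}
    [IsFiniteMeasure μ] {Θ : ℕ → ℝ} (h : HasDecayOfCorrelations f μ Θ) (hf : Measurable f) {g : ℕ}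
    {η : ℝ} (hη : 0 ≤ η) (hΘ : ∀ j, g ≤ j → Θ j ≤ η) {A : Set X} (hA : MeasurableSet A)
    (hAc : A.OrdConnected) : DecorrelatesAfter f μ g (3 * η) A := by
  intro W hW j hj
  have hbv := bvNorm_indicator_le_three hAc
  have hcorr := h.2 (A.indicator 1) (W.indicator 1) (hbv.trans_lt (by norm_num))
    ((integrable_const 1).indicator hW) j
  have hprod : ∫ x, A.indicator (1 : X → ℝ) x * W.indicator (1 : X → ℝ) (f^[j] x) ∂μ
      = μ.real (A ∩ f^[j] ⁻¹' W) := by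
    rw [← integral_indicator_one (hA.inter (hf.iterate j hW))]
    simp_rw [Set.inter_indicator_one]
    rfl
  have habs : ∫ x, |W.indicator (1 : X → ℝ) x| ∂μ = μ.real W := by
    rw [← integral_indicator_one hW]
    congr with x
    exact abs_of_nonneg (Set.indicator_nonneg (fun _ _ => zero_le_one) x)
  rw [correlation, hprod, integral_indicator_one hA, integral_indicator_one hW, habs] at hcorr
  have hnorm : (bvNorm (A.indicator (1 : X → ℝ))).toReal ≤ 3 :=
    ENNReal.toReal_mono (by norm_num) hbv
  calc |μ.real (A ∩ f^[j] ⁻¹' W) - μ.real A * μ.real W|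
      ≤ Θ j * (bvNorm (A.indicator (1 : X → ℝ))).toReal * μ.real W := hcorr
    _ ≤ η * 3 * μ.real W := by gcongr; exact hΘ j hj
    _ = 3 * η * μ.real W := by ring

lemma HasExponentialDecay.exists_decorrelatesAfter {X : Set ℝ} {f : X → X} {μ : Measure X}
    [IsFiniteMeasure μ] (h : HasExponentialDecay f μ) (hf : Measurable f) :
    ∃ C > 0, ∃ θ > 0, ∀ (g : ℕ) (A : Set X), MeasurableSet A → A.OrdConnected →
      DecorrelatesAfter f μ g (C * Real.exp (-θ * g)) A := by
  obtain ⟨C, hC, θ, hθ, hdec⟩ := h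
  refine ⟨3 * C, by positivity, θ, hθ, fun g A hA hAc => ?_⟩
  rw [mul_assoc]
  refine hdec.decorrelatesAfter hf (by positivity) (fun j hj => ?_) hA hAc
  have hgj : (g : ℝ) ≤ j := by exact_mod_cast hj
  exact mul_le_mul_of_nonneg_left (Real.exp_le_exp.2 (by nlinarith)) hC.le

end BoundedVariation

/-- The index of the cell `[iδ, (i+1)δ)` that contains `x`. -/
noncomputable def cellIndex (X : Set ℝ) (δ : ℝ) (x : X) : ℤ := ⌊(x : ℝ) / δ⌋

section CellIndex

variable {X : Set ℝ} {δ : ℝ}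

lemma measurable_cellIndex : Measurable (cellIndex X δ) :=
  (measurable_subtype_coe.div_const δ).floor

lemma monotone_cellIndex (hδ : 0 ≤ δ) : Monotone (cellIndex X δ) := fun _ _ hxy =>
  Int.floor_le_floor (div_le_div_of_nonneg_right hxy hδ)

lemma cellIndex_eq_iff (hδ : 0 < δ) {x : X} {a : ℤ} :
    cellIndex X δ x = a ↔ (x : ℝ) ∈ Set.Ico (a * δ) ((a + 1) * δ) := by
  rw [cellIndex, Int.floor_eq_iff, le_div_iff₀ hδ, div_lt_iff₀ hδ, Set.mem_Ico]

lemma cellWindow_subset_closedBall (hδ : 0 < δ) (w : ℕ) (x : X) :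
    cellWindow (cellIndex X δ) w (cellIndex X δ x) ⊆ Metric.closedBall x ((w + 1) * δ) := by
  intro y hy
  obtain ⟨hx₁, hx₂⟩ := (cellIndex_eq_iff hδ (x := x)).1 rfl
  obtain ⟨hy₁, hy₂⟩ := (cellIndex_eq_iff hδ (x := y)).1 rfl
  obtain ⟨hl, hu⟩ : cellIndex X δ x - (w : ℝ) ≤ cellIndex X δ y ∧
      (cellIndex X δ y : ℝ) ≤ cellIndex X δ x + w := by exact_mod_cast hy
  rw [Metric.mem_closedBall, Subtype.dist_eq, Real.dist_eq, abs_le]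
  constructor <;> nlinarith

lemma closedBall_subset_cellWindow (hδ : 0 < δ) (w : ℕ) (x : X) :
    Metric.closedBall x (w * δ) ⊆ cellWindow (cellIndex X δ) w (cellIndex X δ x) := by
  intro y hy
  obtain ⟨hx₁, hx₂⟩ := (cellIndex_eq_iff hδ (x := x)).1 rfl
  obtain ⟨hy₁, hy₂⟩ := (cellIndex_eq_iff hδ (x := y)).1 rfl
  rw [Metric.mem_closedBall, Subtype.dist_eq, Real.dist_eq, abs_le] at hy
  have hl : (cellIndex X δ x : ℝ) < cellIndex X δ y + w + 1 :=
    lt_of_mul_lt_mul_right (by nlinarith) hδ.le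
  have hu : (cellIndex X δ y : ℝ) < cellIndex X δ x + w + 1 :=
    lt_of_mul_lt_mul_right (by nlinarith) hδ.le
  have hl' : cellIndex X δ x < cellIndex X δ y + w + 1 := by exact_mod_cast hl
  have hu' : cellIndex X δ y < cellIndex X δ x + w + 1 := by exact_mod_cast hu
  exact ⟨by omega, by omega⟩

end CellIndex

section Density

lemma map_withDensity_comp {α β : Type*} [MeasurableSpace α] [MeasurableSpace β] {μ : Measure α}
    {φ : α → β} (hφ : Measurable φ) {F : β → ℝ≥0∞} (hF : Measurable F) :
    (μ.withDensity (F ∘ φ)).map φ = (μ.map φ).withDensity F := by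
  ext s hs
  rw [Measure.map_apply hφ hs, withDensity_apply _ (hφ hs), withDensity_apply _ hs,
    setLIntegral_map hs hF hφ]
  rfl

lemma tendsto_natCast_mul_of_tendsto_div {h : ℝ → ℝ} {ℓ : ℝ}
    (hℓ : Tendsto (fun r => h r / (2 * r)) (𝓝[>] 0) (𝓝 ℓ)) {r : ℕ → ℝ} {t : ℝ} (ht : 0 < t)
    (hr : Tendsto (fun n : ℕ => n * (2 * r n)) atTop (𝓝 t)) :
    Tendsto (fun n : ℕ => n * h (r n)) atTop (𝓝 (t * ℓ)) := by
  have hpos : ∀ᶠ n in atTop, 0 < r n := by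
    filter_upwards [hr.eventually_const_lt ht] with n hn
    exact pos_of_mul_pos_right (pos_of_mul_pos_right hn n.cast_nonneg) zero_le_two
  have hzero : Tendsto r atTop (𝓝 0) := by
    have hlim := (hr.mul (tendsto_inv_atTop_nhds_zero_nat (𝕜 := ℝ))).div_const 2
    rw [mul_zero, zero_div] at hlim
    refine hlim.congr' ?_
    filter_upwards [eventually_gt_atTop 0] with n hn
    field_simp
  refine (hr.mul (hℓ.comp (tendsto_nhdsWithin_iff.2 ⟨hzero, hpos⟩))).congr' ?_
  filter_upwards [hpos] with n hn
  simp only [Function.comp_apply]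
  field_simp

namespace IsLebesgueDensity

variable {X : Set ℝ} {μ : Measure X} {ρ : X → ℝ}

lemma exists_map_val_eq_withDensity (hX : MeasurableSet X) (h : IsLebesgueDensity μ ρ) :
    ∃ F : ℝ → ℝ≥0∞, Measurable F ∧ (∀ x : X, F x = ENNReal.ofReal (ρ x)) ∧
      μ.map Subtype.val = volume.withDensity F := by
  have hemb := MeasurableEmbedding.subtype_coe hX
  obtain ⟨F, hF, hFρ⟩ := hemb.exists_measurable_extend h.measurable.ennreal_ofReal
    fun _ => ⟨0⟩
  refine ⟨X.indicator F, hF.indicator hX, fun x => ?_, ?_⟩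
  · rw [Set.indicator_of_mem x.2]
    exact congrFun hFρ x
  · rw [h.eq_withDensity, ← hFρ, map_withDensity_comp measurable_subtype_coe hF, lebesgueOn,
      map_comap_subtype_coe hX, withDensity_indicator hX]

lemma ae_tendsto_measureReal_closedBall_div [IsFiniteMeasure μ] (hX : MeasurableSet X)
    (h : IsLebesgueDensity μ ρ) :
    ∀ᵐ x ∂μ, Tendsto (fun r => μ.real (Metric.closedBall x r) / (2 * r)) (𝓝[>] 0)
      (𝓝 (ρ x)) := by
  obtain ⟨F, hF, hFρ, hmap⟩ := h.exists_map_val_eq_withDensity hX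
  have hac : μ.map (Subtype.val : X → ℝ) ≪ volume := by
    rw [hmap]; exact withDensity_absolutelyContinuous _ _
  have hderiv : (μ.map (Subtype.val : X → ℝ)).rnDeriv volume =ᵐ[volume] F := by
    rw [hmap]; exact Measure.rnDeriv_withDensity _ hF
  have hdiff := hac.ae_le ((Besicovitch.ae_tendsto_rnDeriv (μ.map Subtype.val) volume).and hderiv)
  filter_upwards [ae_of_ae_map measurable_subtype_coe.aemeasurable hdiff] with x ⟨hx, hFx⟩
  rw [hFx, hFρ] at hx
  have hreal := (ENNReal.tendsto_toReal ENNReal.ofReal_ne_top).comp hx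
  rw [ENNReal.toReal_ofReal (h.nonneg x)] at hreal
  refine hreal.congr' ?_
  filter_upwards [self_mem_nhdsWithin] with r (hr : 0 < r)
  rw [Function.comp_apply, Measure.map_apply measurable_subtype_coe measurableSet_closedBall,
    ENNReal.toReal_div, Real.volume_closedBall, ENNReal.toReal_ofReal (by positivity)]
  rfl

lemma integral_eq (h : IsLebesgueDensity μ ρ) (G : X → ℝ) :
    ∫ x, G x ∂μ = ∫ x, ρ x * G x ∂lebesgueOn X := by
  rw [h.eq_withDensity, integral_withDensity_eq_integral_toReal_smul
    h.measurable.ennreal_ofReal (ae_of_all _ fun _ => ENNReal.ofReal_lt_top)]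
  simp_rw [ENNReal.toReal_ofReal (h.nonneg _), smul_eq_mul]

variable {K : NNReal}

lemma measureReal_closedBall_le (hX : MeasurableSet X) (h : IsLebesgueDensity μ ρ)
    (hK : ∀ x, ρ x ≤ K) (x : X) {r : ℝ} (hr : 0 ≤ r) :
    μ.real (Metric.closedBall x r) ≤ K * (2 * r) := by
  refine ENNReal.toReal_le_of_le_ofReal (by positivity) ?_
  calc μ (Metric.closedBall x r)
      = ∫⁻ y in Metric.closedBall x r, ENNReal.ofReal (ρ y) ∂lebesgueOn X := by
        rw [← withDensity_apply _ measurableSet_closedBall, ← h.eq_withDensity]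
    _ ≤ ∫⁻ _ in Metric.closedBall x r, K ∂lebesgueOn X := by
        gcongr with y
        exact ENNReal.ofReal_le_coe.2 (hK y)
    _ = K * volume (Subtype.val '' Metric.closedBall x r) := by
        rw [setLIntegral_const, lebesgueOn, (MeasurableEmbedding.subtype_coe hX).comap_apply]
    _ ≤ K * volume (Metric.closedBall (x : ℝ) r) := by
        gcongr
        exact Set.image_subset_iff.2 fun _ hy => hy
    _ = ENNReal.ofReal (K * (2 * r)) := by
        rw [Real.volume_closedBall, ENNReal.ofReal_mul K.coe_nonneg, ENNReal.ofReal_coe_nnreal]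

lemma measureReal_cellWindow_le [IsFiniteMeasure μ] (hX : MeasurableSet X)
    (h : IsLebesgueDensity μ ρ) (hK : ∀ x, ρ x ≤ K) {δ : ℝ} (hδ : 0 < δ) (w : ℕ) (x : X) :
    μ.real (cellWindow (cellIndex X δ) w (cellIndex X δ x)) ≤ K * (2 * ((w + 1) * δ)) :=
  (measureReal_mono (cellWindow_subset_closedBall hδ w x)).trans
    (h.measureReal_closedBall_le hX hK x (by positivity))

lemma measureReal_cell_le [IsFiniteMeasure μ] (hX : MeasurableSet X)
    (h : IsLebesgueDensity μ ρ) (hK : ∀ x, ρ x ≤ K) {δ : ℝ} (hδ : 0 < δ) (a : ℤ) :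
    μ.real (cellIndex X δ ⁻¹' {a}) ≤ K * (2 * δ) := by
  obtain hempty | ⟨x, rfl⟩ := (cellIndex X δ ⁻¹' {a}).eq_empty_or_nonempty
  · rw [hempty, measureReal_empty]
    positivity
  · simpa [cellWindow] using h.measureReal_cellWindow_le hX hK hδ 0 x

variable [IsFiniteMeasure μ] {δ : ℕ → ℝ} {w : ℕ → ℕ} {t : ℝ}

lemma ae_tendsto_mul_measureReal_cellWindow (hX : MeasurableSet X) (h : IsLebesgueDensity μ ρ)
    (ht : 0 < t) (hδ : ∀ᶠ n in atTop, 0 < δ n)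
    (hδ₀ : Tendsto (fun n : ℕ => n * δ n) atTop (𝓝 0))
    (hwδ : Tendsto (fun n : ℕ => n * (2 * (w n * δ n))) atTop (𝓝 t)) :
    ∀ᵐ x ∂μ, Tendsto
      (fun n : ℕ => n * μ.real (cellWindow (cellIndex X (δ n)) (w n) (cellIndex X (δ n) x)))
      atTop (𝓝 (t * ρ x)) := by
  have hwδ' : Tendsto (fun n : ℕ => n * (2 * ((w n + 1) * δ n))) atTop (𝓝 t) := by
    simpa [mul_add, add_mul, mul_left_comm] using hwδ.add (hδ₀.const_mul 2)
  filter_upwards [h.ae_tendsto_measureReal_closedBall_div hX] with x hx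
  refine tendsto_of_tendsto_of_tendsto_of_le_of_le'
    (tendsto_natCast_mul_of_tendsto_div hx ht hwδ) (tendsto_natCast_mul_of_tendsto_div hx ht hwδ')
    ?_ ?_ <;> filter_upwards [hδ] with n hn
  · exact mul_le_mul_of_nonneg_left
      (measureReal_mono (closedBall_subset_cellWindow hn (w n) x)) n.cast_nonneg
  · exact mul_le_mul_of_nonneg_left
      (measureReal_mono (cellWindow_subset_closedBall hn (w n) x)) n.cast_nonneg

lemma tendsto_integral_mul_measureReal_cellWindow_pow (hX : MeasurableSet X)
    (h : IsLebesgueDensity μ ρ) (hK : ∀ x, ρ x ≤ K) (ht : 0 < t) (hδ : ∀ᶠ n in atTop, 0 < δ n)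
    (hδ₀ : Tendsto (fun n : ℕ => n * δ n) atTop (𝓝 0))
    (hwδ : Tendsto (fun n : ℕ => n * (2 * (w n * δ n))) atTop (𝓝 t)) (m : ℕ) :
    Tendsto (fun n : ℕ => (n : ℝ) ^ m *
        ∫ x, μ.real (cellWindow (cellIndex X (δ n)) (w n) (cellIndex X (δ n) x)) ^ m ∂μ)
      atTop (𝓝 (∫ x, (t * ρ x) ^ m ∂μ)) := by
  have hwδ' : Tendsto (fun n : ℕ => n * (2 * ((w n + 1) * δ n))) atTop (𝓝 t) := by
    simpa [mul_add, add_mul, mul_left_comm] using hwδ.add (hδ₀.const_mul 2)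
  simp_rw [← integral_const_mul, ← mul_pow]
  refine tendsto_integral_filter_of_dominated_convergence (fun _ => (K * (t + 1)) ^ m)
    (.of_forall fun n => ?_) ?_ (integrable_const _) ?_
  · exact ((measurable_from_top (f := fun a : ℤ =>
      (n * μ.real (cellWindow (cellIndex X (δ n)) (w n) a)) ^ m)).comp
      measurable_cellIndex).aestronglyMeasurable
  · filter_upwards [hδ, hwδ'.eventually_le_const (lt_add_one t)] with n hn hle
    refine ae_of_all _ fun x => ?_
    rw [Real.norm_of_nonneg (by positivity)]
    refine pow_le_pow_left₀ (by positivity) ?_ m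
    calc n * μ.real (cellWindow (cellIndex X (δ n)) (w n) (cellIndex X (δ n) x))
        ≤ n * (K * (2 * ((w n + 1) * δ n))) := by
          gcongr
          exact h.measureReal_cellWindow_le hX hK hn (w n) x
      _ = K * (n * (2 * ((w n + 1) * δ n))) := mul_left_comm ..
      _ ≤ K * (t + 1) := by gcongr
  · filter_upwards [h.ae_tendsto_mul_measureReal_cellWindow hX ht hδ hδ₀ hwδ] with x hx
    exact hx.pow m

end IsLebesgueDensity

end Density

section Counting

open Classical in
/-- The sets of `m` times in `T` that are `g`-separated. -/
noncomputable def separatedSets (g m : ℕ) (T : Finset ℕ) : Finset (Finset ℕ) :=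
  (T.powersetCard m).filter (SeparatedBy g)

open Classical in
/-- The sets of `m` times in `T` that are not `g`-separated. -/
noncomputable def clusteredSets (g m : ℕ) (T : Finset ℕ) : Finset (Finset ℕ) :=
  (T.powersetCard m).filter fun s => ¬ SeparatedBy g s

variable {g m : ℕ} {T s : Finset ℕ}

lemma mem_separatedSets :
    s ∈ separatedSets g m T ↔ (s ⊆ T ∧ s.card = m) ∧ SeparatedBy g s := by
  simp [separatedSets, Finset.mem_powersetCard]

lemma mem_clusteredSets :
    s ∈ clusteredSets g m T ↔ (s ⊆ T ∧ s.card = m) ∧ ¬ SeparatedBy g s := by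
  simp [clusteredSets, Finset.mem_powersetCard]

lemma sum_separatedSets_add_sum_clusteredSets (g m : ℕ) (T : Finset ℕ) (F : Finset ℕ → ℝ) :
    ∑ s ∈ separatedSets g m T, F s + ∑ s ∈ clusteredSets g m T, F s
      = ∑ s ∈ T.powersetCard m, F s := by
  classical
  unfold separatedSets clusteredSets
  convert Finset.sum_filter_add_sum_filter_not (T.powersetCard m) (SeparatedBy g) F

lemma exists_add_mem_of_not_separatedBy (h : ¬ SeparatedBy g s) :
    ∃ i ∈ s, ∃ l, 1 ≤ l ∧ l < g ∧ i + l ∈ s := by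
  simp only [SeparatedBy, not_forall] at h
  obtain ⟨i, hi, j, hj, hij, hg⟩ := h
  exact ⟨i, hi, j - i, by omega, by omega, by rwa [Nat.add_sub_cancel' hij.le]⟩

lemma separatedBy_of_card_le_one (hs : s.card ≤ 1) : SeparatedBy g s :=
  fun i hi j hj hij => absurd (Finset.card_le_one.1 hs i hi j hj) hij.ne

lemma card_clusteredSets_add_two_le (g k : ℕ) (T : Finset ℕ) :
    (clusteredSets g (k + 2) T).card ≤ T.card * g * T.card.choose k := by
  classical
  have hsub : clusteredSets g (k + 2) T ⊆
      ((T ×ˢ Finset.range g) ×ˢ T.powersetCard k).image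
        fun p => insert p.1.1 (insert (p.1.1 + p.1.2) p.2) := by
    intro s hs
    obtain ⟨⟨hsT, hc⟩, hns⟩ := mem_clusteredSets.1 hs
    obtain ⟨i, hi, l, hl, hlg, hil⟩ := exists_add_mem_of_not_separatedBy hns
    have hne : i + l ∈ s.erase i := Finset.mem_erase.2 ⟨by omega, hil⟩
    refine Finset.mem_image.2 ⟨((i, l), (s.erase i).erase (i + l)), ?_, ?_⟩
    · simp only [Finset.mem_product, Finset.mem_range, Finset.mem_powersetCard]
      refine ⟨⟨hsT hi, hlg⟩,
        ((Finset.erase_subset _ _).trans (Finset.erase_subset _ _)).trans hsT, ?_⟩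
      rw [Finset.card_erase_of_mem hne, Finset.card_erase_of_mem hi]
      omega
    · dsimp only
      rw [Finset.insert_erase hne, Finset.insert_erase hi]
  simpa only [Finset.card_product, Finset.card_range, Finset.card_powersetCard]
    using (Finset.card_le_card hsub).trans Finset.card_image_le

lemma card_clusteredSets_mul_le {n : ℕ} (hT : T.card ≤ n) :
    (clusteredSets g m T).card * n ≤ g * n ^ m := by
  rcases lt_or_ge m 2 with hm | hm
  · have : clusteredSets g m T = ∅ := by
      refine Finset.eq_empty_of_forall_notMem fun s hs => ?_
      obtain ⟨⟨-, hc⟩, hns⟩ := mem_clusteredSets.1 hs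
      exact hns (separatedBy_of_card_le_one (by omega))
    simp [this]
  · obtain ⟨k, rfl⟩ := Nat.exists_eq_add_of_le' hm
    have hchoose : T.card.choose k ≤ n ^ k :=
      (Nat.choose_le_pow _ _).trans (Nat.pow_le_pow_left hT k)
    calc (clusteredSets g (k + 2) T).card * n
        ≤ T.card * g * T.card.choose k * n :=
          Nat.mul_le_mul_right _ (card_clusteredSets_add_two_le g k T)
      _ ≤ n * g * n ^ k * n := by gcongr
      _ = g * n ^ (k + 2) := by ring

lemma tendsto_choose_div_pow {N : ℕ → ℕ} (hN : Tendsto (fun n => (N n : ℝ) / n) atTop (𝓝 1))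
    (m : ℕ) :
    Tendsto (fun n : ℕ => ((N n).choose m : ℝ) / (n : ℝ) ^ m) atTop (𝓝 (1 / m.factorial)) := by
  have hN_top : Tendsto N atTop atTop := by
    refine tendsto_natCast_atTop_iff.1 ((hN.pos_mul_atTop one_pos
      (tendsto_natCast_atTop_atTop (R := ℝ))).congr' ?_)
    filter_upwards [eventually_ne_atTop 0] with n hn
    exact div_mul_cancel₀ _ (Nat.cast_ne_zero.2 hn)
  have hratio : Tendsto (fun N : ℕ => (N.choose m : ℝ) / ((N : ℝ) ^ m / m.factorial)) atTop
      (𝓝 1) := by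
    refine (Asymptotics.isEquivalent_iff_tendsto_one ?_).1 (isEquivalent_choose m)
    filter_upwards [eventually_ne_atTop 0] with N hN
    positivity
  have h := ((hratio.comp hN_top).mul (hN.pow m)).div_const (m.factorial : ℝ)
  rw [one_pow, one_mul] at h
  refine h.congr' ?_
  filter_upwards [hN_top.eventually_ne_atTop 0] with n hn
  have : (N n : ℝ) ≠ 0 := Nat.cast_ne_zero.2 hn
  simp only [Function.comp_apply, div_pow]
  field_simp

lemma tendsto_card_separatedSets_div_pow {g : ℕ → ℕ} {T : ℕ → Finset ℕ}
    (hg : Tendsto (fun n => (g n : ℝ) / n) atTop (𝓝 0)) (hT_le : ∀ n, (T n).card ≤ n)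
    (hT : Tendsto (fun n => ((T n).card : ℝ) / n) atTop (𝓝 1)) (m : ℕ) :
    Tendsto (fun n : ℕ => ((separatedSets (g n) m (T n)).card : ℝ) / (n : ℝ) ^ m) atTop
      (𝓝 (1 / m.factorial)) := by
  have hclustered : Tendsto
      (fun n : ℕ => ((clusteredSets (g n) m (T n)).card : ℝ) / (n : ℝ) ^ m) atTop (𝓝 0) := by
    refine squeeze_zero' (Eventually.of_forall fun n => by positivity) ?_ hg
    filter_upwards [eventually_gt_atTop 0] with n hn
    have hn' : (0 : ℝ) < n := by exact_mod_cast hn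
    rw [div_le_div_iff₀ (by positivity) hn']
    exact_mod_cast card_clusteredSets_mul_le (g := g n) (m := m) (hT_le n)
  have h := (tendsto_choose_div_pow hT m).sub hclustered
  rw [sub_zero] at h
  refine h.congr fun n => ?_
  have hsplit := sum_separatedSets_add_sum_clusteredSets (g n) m (T n) fun _ => 1
  simp only [Finset.sum_const, nsmul_eq_mul, mul_one, Finset.card_powersetCard] at hsplit
  rw [← hsplit, ← sub_div, add_sub_cancel_right]

end Counting

section HitCount

variable {Ω ι : Type*} {U : ι → Set Ω}

open Classical in
/-- The number of indices in `T` whose event `U j` happens at `x`. -/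
noncomputable def hitCount (U : ι → Set Ω) (T : Finset ι) (x : Ω) : ℕ :=
  (T.filter fun j => x ∈ U j).card

lemma hitCount_le_card (U : ι → Set Ω) (T : Finset ι) (x : Ω) : hitCount U T x ≤ T.card := by
  classical exact Finset.card_filter_le _ _

lemma choose_hitCount (U : ι → Set Ω) (T : Finset ι) (m : ℕ) (x : Ω) :
    ((hitCount U T x).choose m : ℝ)
      = ∑ s ∈ T.powersetCard m, (⋂ j ∈ s, U j).indicator 1 x := by
  classical
  simp only [Set.indicator_apply, Pi.one_apply]
  rw [Finset.sum_boole, hitCount, ← Finset.card_powersetCard]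
  congr 2
  ext s
  simp only [Finset.mem_powersetCard, Finset.mem_filter, Finset.subset_iff, Set.mem_iInter, imp_and,
    forall_and]
  tauto

variable [MeasurableSpace Ω] {μ : Measure Ω}

lemma measurable_hitCount (hU : ∀ j, MeasurableSet (U j)) (T : Finset ι) :
    Measurable (hitCount U T) := by
  classical
  have : hitCount U T = fun x => ∑ j ∈ T, (U j).indicator 1 x := by
    funext x
    simp only [hitCount, Set.indicator_apply, Finset.card_filter, Pi.one_apply]
  rw [this]
  exact Finset.measurable_sum _ fun j _ => measurable_one.indicator (hU j)

lemma integrable_comp_hitCount [IsFiniteMeasure μ] (hU : ∀ j, MeasurableSet (U j)) (T : Finset ι)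
    (F : ℕ → ℝ) : Integrable (fun x => F (hitCount U T x)) μ := by
  have hm : Measurable fun x => F (hitCount U T x) :=
    (measurable_from_top (f := F)).comp (measurable_hitCount hU T)
  refine Integrable.of_bound hm.aestronglyMeasurable
    (∑ i ∈ Finset.range (T.card + 1), |F i|) (ae_of_all _ fun x => ?_)
  exact Finset.single_le_sum (f := fun i => |F i|) (fun i _ => abs_nonneg _)
    (Finset.mem_range.2 (Nat.lt_succ_of_le (hitCount_le_card U T x)))

lemma integral_sum_indicator_biInter [IsFiniteMeasure μ] (hU : ∀ j, MeasurableSet (U j))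
    (S : Finset (Finset ι)) :
    ∫ x, ∑ s ∈ S, (⋂ j ∈ s, U j).indicator (1 : Ω → ℝ) x ∂μ
      = ∑ s ∈ S, μ.real (⋂ j ∈ s, U j) := by
  have hmeas (s : Finset ι) : MeasurableSet (⋂ j ∈ s, U j) :=
    Finset.measurableSet_biInter _ fun j _ => hU j
  rw [integral_finsetSum _ fun s _ => (integrable_const _).indicator (hmeas s)]
  exact Finset.sum_congr rfl fun s _ => integral_indicator_one (hmeas s)

lemma integral_choose_hitCount [IsFiniteMeasure μ] (hU : ∀ j, MeasurableSet (U j)) (T : Finset ι)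
    (m : ℕ) :
    ∫ x, ((hitCount U T x).choose m : ℝ) ∂μ = ∑ s ∈ T.powersetCard m, μ.real (⋂ j ∈ s, U j) := by
  simp_rw [choose_hitCount]
  exact integral_sum_indicator_biInter hU _

lemma pow_le_add_mul_choose (N q : ℕ) :
    (N : ℝ) ^ q ≤ (2 * q : ℝ) ^ q + 2 ^ q * q.factorial * N.choose q := by
  rcases le_or_gt N (2 * q) with h | h
  · have hN : (N : ℝ) ≤ 2 * q := by exact_mod_cast h
    have hpow : (N : ℝ) ^ q ≤ (2 * q : ℝ) ^ q := pow_le_pow_left₀ (by positivity) hN q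
    exact hpow.trans (le_add_of_nonneg_right (by positivity))
  · have hN : (N : ℝ) ≤ 2 * ((N + 1 - q : ℕ) : ℝ) := by
      exact_mod_cast (by omega : N ≤ 2 * (N + 1 - q))
    have hchoose : ((N + 1 - q : ℕ) : ℝ) ^ q ≤ N.choose q * q.factorial :=
      (div_le_iff₀ (by positivity)).1 (Nat.pow_le_choose (α := ℝ) q N)
    calc (N : ℝ) ^ q ≤ (2 * ((N + 1 - q : ℕ) : ℝ)) ^ q := pow_le_pow_left₀ (by positivity) hN q
      _ = 2 ^ q * ((N + 1 - q : ℕ) : ℝ) ^ q := mul_pow _ _ _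
      _ ≤ 2 ^ q * (N.choose q * q.factorial) := by gcongr
      _ = 2 ^ q * q.factorial * N.choose q := by ring
      _ ≤ _ := le_add_of_nonneg_left (by positivity)

lemma integral_choose_hitCount_le [IsFiniteMeasure μ] (hU : ∀ j, MeasurableSet (U j))
    {T : Finset ι} {n q : ℕ} {D : ℝ} (hn : 0 < n) (hT : T.card ≤ n) (hD₀ : 0 ≤ D)
    (hD : ∀ s ⊆ T, s.card = q → (n : ℝ) ^ q * μ.real (⋂ j ∈ s, U j) ≤ D) :
    ∫ x, ((hitCount U T x).choose q : ℝ) ∂μ ≤ D := by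
  have : (0 : ℝ) < n := by exact_mod_cast hn
  rw [integral_choose_hitCount hU]
  calc ∑ s ∈ T.powersetCard q, μ.real (⋂ j ∈ s, U j)
      ≤ ∑ _s ∈ T.powersetCard q, D / n ^ q := by
        refine Finset.sum_le_sum fun s hs => ?_
        obtain ⟨hsT, hcard⟩ := Finset.mem_powersetCard.1 hs
        rw [le_div_iff₀' (by positivity)]
        exact hD s hsT hcard
    _ = (T.card.choose q : ℝ) * (D / n ^ q) := by simp
    _ ≤ (n : ℝ) ^ q * (D / n ^ q) := by
        gcongr
        exact_mod_cast (Nat.choose_le_pow _ _).trans (Nat.pow_le_pow_left hT q)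
    _ = D := by field_simp

lemma integral_hitCount_pow_le [IsProbabilityMeasure μ] (hU : ∀ j, MeasurableSet (U j))
    {T : Finset ι} {n q : ℕ} {D : ℝ} (hn : 0 < n) (hT : T.card ≤ n) (hD₀ : 0 ≤ D)
    (hD : ∀ s ⊆ T, s.card = q → (n : ℝ) ^ q * μ.real (⋂ j ∈ s, U j) ≤ D) :
    ∫ x, (hitCount U T x : ℝ) ^ q ∂μ ≤ (2 * q : ℝ) ^ q + 2 ^ q * q.factorial * D := by
  calc ∫ x, (hitCount U T x : ℝ) ^ q ∂μ
      ≤ ∫ x, ((2 * q : ℝ) ^ q + 2 ^ q * q.factorial * (hitCount U T x).choose q) ∂μ :=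
        integral_mono (integrable_comp_hitCount hU T fun N => (N : ℝ) ^ q)
          (integrable_comp_hitCount hU T fun N =>
            (2 * q : ℝ) ^ q + 2 ^ q * q.factorial * N.choose q)
          fun x => pow_le_add_mul_choose _ _
    _ = (2 * q : ℝ) ^ q + 2 ^ q * q.factorial * ∫ x, ((hitCount U T x).choose q : ℝ) ∂μ := by
        rw [integral_add (integrable_const _)
          (integrable_comp_hitCount hU T fun N => 2 ^ q * q.factorial * (N.choose q : ℝ)),
          integral_const_mul, integral_const, probReal_univ, one_smul]
    _ ≤ _ := by
        gcongr
        exact integral_choose_hitCount_le hU hn hT hD₀ hD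

end HitCount

section SeparatedHits

variable {Ω : Type*} {U : ℕ → Set Ω} {T : Finset ℕ} {g n : ℕ}

lemma hitCount_eq_sum_mod (hg : 0 < g) (U : ℕ → Set Ω) (T : Finset ℕ) (x : Ω) :
    hitCount U T x = ∑ c ∈ Finset.range g, hitCount U (T.filter fun j => j % g = c) x := by
  classical
  unfold hitCount
  rw [Finset.card_eq_sum_card_fiberwise (f := fun j => j % g) (t := Finset.range g)]
  · exact Finset.sum_congr rfl fun c _ => by rw [Finset.filter_comm]
  · intro j _
    simpa using Nat.mod_lt j hg

lemma separatedBy_of_subset_filter_mod {s : Finset ℕ} {c : ℕ}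
    (hs : s ⊆ T.filter fun j => j % g = c) : SeparatedBy g s := by
  intro i hi j hj hij
  have hmod : i ≡ j [MOD g] :=
    (Finset.mem_filter.1 (hs hi)).2.trans (Finset.mem_filter.1 (hs hj)).2.symm
  have := Nat.le_of_dvd (by omega) ((Nat.modEq_iff_dvd' hij.le).1 hmod)
  omega

/-- The event that two events `U i`, `U (i + l)` with `i ∈ T` and `1 ≤ l < g` both happen. -/
def closePairSet (U : ℕ → Set Ω) (g : ℕ) (T : Finset ℕ) : Set Ω :=
  ⋃ p ∈ T ×ˢ Finset.Ico 1 g, U p.1 ∩ U (p.1 + p.2)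

lemma biInter_subset_closePairSet {m : ℕ} {s : Finset ℕ} (hs : s ∈ clusteredSets g m T) :
    ⋂ j ∈ s, U j ⊆ closePairSet U g T := by
  obtain ⟨⟨hsT, -⟩, hns⟩ := mem_clusteredSets.1 hs
  obtain ⟨i, hi, l, hl, hlg, hil⟩ := exists_add_mem_of_not_separatedBy hns
  refine fun x hx => Set.mem_biUnion (x := (i, l)) (by simp [hsT hi, hl, hlg]) ?_
  rw [Set.mem_iInter₂] at hx
  exact ⟨hx i hi, hx _ hil⟩

lemma sum_clusteredSets_indicator_le {h : ℝ} (hh : 0 < h) (U : ℕ → Set Ω) (T : Finset ℕ)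
    (g m : ℕ) (x : Ω) :
    ∑ s ∈ clusteredSets g m T, (⋂ j ∈ s, U j).indicator (1 : Ω → ℝ) x
      ≤ h * (closePairSet U g T).indicator 1 x + (hitCount U T x : ℝ) ^ (2 * m) / h := by
  classical
  by_cases hx : x ∈ closePairSet U g T
  · calc ∑ s ∈ clusteredSets g m T, (⋂ j ∈ s, U j).indicator (1 : Ω → ℝ) x
        ≤ ∑ s ∈ T.powersetCard m, (⋂ j ∈ s, U j).indicator (1 : Ω → ℝ) x :=
          Finset.sum_le_sum_of_subset_of_nonneg (Finset.filter_subset _ _) fun s _ _ =>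
            Set.indicator_nonneg (fun _ _ => zero_le_one) x
      _ = ((hitCount U T x).choose m : ℝ) := (choose_hitCount U T m x).symm
      _ ≤ (hitCount U T x : ℝ) ^ m := by exact_mod_cast Nat.choose_le_pow _ _
      _ ≤ h + ((hitCount U T x : ℝ) ^ m) ^ 2 / h := by
          rw [← sub_nonneg]
          have : h + ((hitCount U T x : ℝ) ^ m) ^ 2 / h - (hitCount U T x : ℝ) ^ m
              = ((h - (hitCount U T x : ℝ) ^ m) ^ 2 + h * (hitCount U T x : ℝ) ^ m) / h := by
            field_simp
            ring
          rw [this]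
          positivity
      _ = _ := by
          rw [Set.indicator_of_mem hx, Pi.one_apply, mul_one, ← pow_mul, mul_comm m]
  · rw [Finset.sum_eq_zero fun s hs => Set.indicator_of_notMem
      (fun hxs => hx (biInter_subset_closePairSet hs hxs)) _, Set.indicator_of_notMem hx]
    positivity

variable [MeasurableSpace Ω] {μ : Measure Ω}

lemma measurableSet_closePairSet (hU : ∀ j, MeasurableSet (U j)) (g : ℕ) (T : Finset ℕ) :
    MeasurableSet (closePairSet U g T) :=
  Finset.measurableSet_biUnion _ fun _ _ => (hU _).inter (hU _)

lemma measureReal_closePairSet_le {ε : ℝ}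
    (hε₀ : 0 ≤ ε) (hε : ∀ i ∈ T, ∀ l, 1 ≤ l → l < g → μ.real (U i ∩ U (i + l)) ≤ ε) :
    μ.real (closePairSet U g T) ≤ T.card * g * ε := by
  calc μ.real (closePairSet U g T)
      ≤ ∑ p ∈ T ×ˢ Finset.Ico 1 g, μ.real (U p.1 ∩ U (p.1 + p.2)) :=
        measureReal_biUnion_finset_le _ _
    _ ≤ ∑ _p ∈ T ×ˢ Finset.Ico 1 g, ε := by
        refine Finset.sum_le_sum fun p hp => ?_
        obtain ⟨hi, hl⟩ := Finset.mem_product.1 hp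
        exact hε _ hi _ (Finset.mem_Ico.1 hl).1 (Finset.mem_Ico.1 hl).2
    _ = (T.card : ℝ) * (g - 1 : ℕ) * ε := by simp
    _ ≤ T.card * g * ε := by
        gcongr
        exact Nat.sub_le _ _

variable [IsProbabilityMeasure μ]

/-- Times in one residue class modulo `g` are `g`-separated, and the hits split over `g` classes. -/
lemma integral_hitCount_pow_le_of_separatedBy (hU : ∀ j, MeasurableSet (U j)) {q : ℕ} {D : ℝ}
    (hn : 0 < n) (hT : T.card ≤ n) (hg : 0 < g) (hD₀ : 0 ≤ D)
    (hD : ∀ s ∈ separatedSets g q T, (n : ℝ) ^ q * μ.real (⋂ j ∈ s, U j) ≤ D) :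
    ∫ x, (hitCount U T x : ℝ) ^ q ∂μ
      ≤ (g : ℝ) ^ q * ((2 * q : ℝ) ^ q + 2 ^ q * q.factorial * D) := by
  have hclass (c : ℕ) : ∫ x, (hitCount U (T.filter fun j => j % g = c) x : ℝ) ^ q ∂μ
      ≤ (2 * q : ℝ) ^ q + 2 ^ q * q.factorial * D :=
    integral_hitCount_pow_le hU hn ((Finset.card_filter_le _ _).trans hT) hD₀ fun s hs hcard =>
      hD s (mem_separatedSets.2
        ⟨⟨hs.trans (Finset.filter_subset _ _), hcard⟩, separatedBy_of_subset_filter_mod hs⟩)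
  have hint (c : ℕ) : Integrable
      (fun x => (hitCount U (T.filter fun j => j % g = c) x : ℝ) ^ q) μ :=
    integrable_comp_hitCount hU _ fun N => (N : ℝ) ^ q
  rcases q with _ | p
  · simpa using hD₀
  calc ∫ x, (hitCount U T x : ℝ) ^ (p + 1) ∂μ
      ≤ ∫ x, (g : ℝ) ^ p * ∑ c ∈ Finset.range g,
          (hitCount U (T.filter fun j => j % g = c) x : ℝ) ^ (p + 1) ∂μ := by
        refine integral_mono (integrable_comp_hitCount hU T fun N => (N : ℝ) ^ (p + 1))
          ((integrable_finsetSum _ fun c _ => hint c).const_mul _) fun x => ?_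
        simpa [hitCount_eq_sum_mod hg U T x] using
          pow_sum_le_card_mul_sum_pow (s := Finset.range g)
            (f := fun c => (hitCount U (T.filter fun j => j % g = c) x : ℝ))
            (fun _ _ => Nat.cast_nonneg _) p
    _ = (g : ℝ) ^ p * ∑ c ∈ Finset.range g,
          ∫ x, (hitCount U (T.filter fun j => j % g = c) x : ℝ) ^ (p + 1) ∂μ := by
        rw [integral_const_mul, integral_finsetSum _ fun c _ => hint c]
    _ ≤ (g : ℝ) ^ p * ∑ _c ∈ Finset.range g,
          ((2 * ↑(p + 1) : ℝ) ^ (p + 1) + 2 ^ (p + 1) * (p + 1).factorial * D) := by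
        gcongr with c _
        exact hclass c
    _ = _ := by
        rw [Finset.sum_const, Finset.card_range, nsmul_eq_mul, ← mul_assoc, ← pow_succ]

lemma sum_clusteredSets_measureReal_le (hU : ∀ j, MeasurableSet (U j)) {m : ℕ} {ε h : ℝ}
    (hh : 0 < h) (hε₀ : 0 ≤ ε)
    (hε : ∀ i ∈ T, ∀ l, 1 ≤ l → l < g → μ.real (U i ∩ U (i + l)) ≤ ε) :
    ∑ s ∈ clusteredSets g m T, μ.real (⋂ j ∈ s, U j)
      ≤ h * (T.card * g * ε) + (∫ x, (hitCount U T x : ℝ) ^ (2 * m) ∂μ) / h := by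
  have hpair := measurableSet_closePairSet hU g T
  have hint_pair : Integrable (fun x => h * (closePairSet U g T).indicator (1 : Ω → ℝ) x) μ :=
    ((integrable_const _).indicator hpair).const_mul _
  have hint_hit : Integrable (fun x => (hitCount U T x : ℝ) ^ (2 * m) / h) μ :=
    integrable_comp_hitCount hU T fun N => (N : ℝ) ^ (2 * m) / h
  rw [← integral_sum_indicator_biInter hU]
  calc ∫ x, ∑ s ∈ clusteredSets g m T, (⋂ j ∈ s, U j).indicator (1 : Ω → ℝ) x ∂μ
      ≤ ∫ x, (h * (closePairSet U g T).indicator 1 x + (hitCount U T x : ℝ) ^ (2 * m) / h) ∂μ :=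
        integral_mono (integrable_finsetSum _ fun s _ => (integrable_const _).indicator
          (Finset.measurableSet_biInter _ fun j _ => hU j)) (hint_pair.add hint_hit)
          (sum_clusteredSets_indicator_le hh U T g m)
    _ = h * μ.real (closePairSet U g T) + (∫ x, (hitCount U T x : ℝ) ^ (2 * m) ∂μ) / h := by
        rw [integral_add hint_pair hint_hit, integral_const_mul, integral_div,
          integral_indicator_one hpair]
    _ ≤ _ := by
        gcongr
        exact measureReal_closePairSet_le hε₀ hε

end SeparatedHits

section FactorialMoments

variable {Ω : Type*} [MeasurableSpace Ω] {μ : Measure Ω} {U : ℕ → ℕ → Set Ω} {T : ℕ → Finset ℕ}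
  {g : ℕ → ℕ}

/-- The events `U n j` at any `m` times of `T n` that are `g n`-separated have joint probability
asymptotic to `Λ / n ^ m`, uniformly in the choice of the times. -/
def HasSeparatedAsymptotics (μ : Measure Ω) (U : ℕ → ℕ → Set Ω) (T : ℕ → Finset ℕ) (g : ℕ → ℕ)
    (m : ℕ) (Λ : ℝ) : Prop :=
  ∀ ε > 0, ∀ᶠ n : ℕ in atTop, ∀ s ∈ separatedSets (g n) m (T n),
    |(n : ℝ) ^ m * μ.real (⋂ j ∈ s, U n j) - Λ| ≤ ε

namespace HasSeparatedAsymptotics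

lemma eventually_le {m : ℕ} {Λ : ℝ} (h : HasSeparatedAsymptotics μ U T g m Λ) :
    ∀ᶠ n : ℕ in atTop, ∀ s ∈ separatedSets (g n) m (T n),
      (n : ℝ) ^ m * μ.real (⋂ j ∈ s, U n j) ≤ |Λ| + 1 := by
  filter_upwards [h 1 one_pos] with n hn s hs
  linarith [(abs_le.1 (hn s hs)).2, le_abs_self Λ]

lemma tendsto_sum {m : ℕ} {Λ : ℝ} (h : HasSeparatedAsymptotics μ U T g m Λ)
    (hg : Tendsto (fun n => (g n : ℝ) / n) atTop (𝓝 0)) (hT_le : ∀ n, (T n).card ≤ n)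
    (hT : Tendsto (fun n => ((T n).card : ℝ) / n) atTop (𝓝 1)) :
    Tendsto (fun n => ∑ s ∈ separatedSets (g n) m (T n), μ.real (⋂ j ∈ s, U n j)) atTop
      (𝓝 (Λ / m.factorial)) := by
  have hcard := tendsto_card_separatedSets_div_pow hg hT_le hT m
  have herror : (fun n : ℕ => ∑ s ∈ separatedSets (g n) m (T n),
      (μ.real (⋂ j ∈ s, U n j) - Λ / (n : ℝ) ^ m)) =o[atTop]
      fun n : ℕ => ((separatedSets (g n) m (T n)).card : ℝ) / (n : ℝ) ^ m := by
    refine Asymptotics.isLittleO_iff.2 fun ε hε => ?_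
    filter_upwards [h ε hε, eventually_gt_atTop 0] with n hn hn0
    have hpow : (0 : ℝ) < (n : ℝ) ^ m := by positivity
    have hterm : ∀ s ∈ separatedSets (g n) m (T n),
        ‖μ.real (⋂ j ∈ s, U n j) - Λ / (n : ℝ) ^ m‖ ≤ ε / (n : ℝ) ^ m := fun s hs => by
      rw [le_div_iff₀' hpow, Real.norm_eq_abs, ← abs_of_pos hpow, ← abs_mul, abs_of_pos hpow,
        mul_sub, mul_div_cancel₀ _ hpow.ne']
      exact hn s hs
    calc ‖∑ s ∈ separatedSets (g n) m (T n), (μ.real (⋂ j ∈ s, U n j) - Λ / (n : ℝ) ^ m)‖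
        ≤ ∑ _s ∈ separatedSets (g n) m (T n), ε / (n : ℝ) ^ m := norm_sum_le_of_le _ hterm
      _ = ε * ‖((separatedSets (g n) m (T n)).card : ℝ) / (n : ℝ) ^ m‖ := by
        rw [Finset.sum_const, nsmul_eq_mul, Real.norm_of_nonneg (div_nonneg (Nat.cast_nonneg _)
          hpow.le), mul_div_left_comm]
  have hzero := (Asymptotics.isLittleO_one_iff ℝ).1 (herror.trans_isBigO (hcard.isBigO_one ℝ))
  have hsum := hzero.add (hcard.mul_const Λ)
  rw [zero_add, one_div_mul_eq_div] at hsum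
  refine hsum.congr fun n => ?_
  rw [Finset.sum_sub_distrib, Finset.sum_const, nsmul_eq_mul]
  ring

end HasSeparatedAsymptotics

variable [IsProbabilityMeasure μ]

lemma tendsto_sum_clusteredSets {m : ℕ} (hU : ∀ n j, MeasurableSet (U n j))
    (hg_top : Tendsto g atTop atTop) (hT_le : ∀ n, (T n).card ≤ n)
    {Λ : ℝ} (hsep : HasSeparatedAsymptotics μ U T g (2 * m) Λ)
    {ε : ℕ → ℝ} (hε₀ : ∀ n, 0 ≤ ε n) (hε : ∀ᶠ n in atTop, ∀ i ∈ T n, ∀ l, 1 ≤ l → l < g n →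
      μ.real (U n i ∩ U n (i + l)) ≤ ε n)
    (hlim : ∀ q : ℕ, Tendsto (fun n : ℕ => (g n : ℝ) ^ q * (n * ε n)) atTop (𝓝 0)) :
    Tendsto (fun n => ∑ s ∈ clusteredSets (g n) m (T n), μ.real (⋂ j ∈ s, U n j)) atTop
      (𝓝 0) := by
  set B : ℝ := (2 * (2 * m : ℕ) : ℝ) ^ (2 * m) + 2 ^ (2 * m) * (2 * m).factorial * (|Λ| + 1)
  have hupper : Tendsto (fun n : ℕ => (g n : ℝ) ^ (2 * m + 2) * (n * ε n) + B / g n) atTop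
      (𝓝 0) := by
    simpa using (hlim (2 * m + 2)).add
      ((tendsto_natCast_atTop_atTop.comp hg_top).const_div_atTop B)
  refine squeeze_zero' (Eventually.of_forall fun n => Finset.sum_nonneg fun s _ =>
    measureReal_nonneg) ?_ hupper
  filter_upwards [hε, hsep.eventually_le, eventually_gt_atTop 0, hg_top.eventually_gt_atTop 0]
    with n hεn hsepn hn hgn
  have : (0 : ℝ) < g n := by exact_mod_cast hgn
  have hmoment : ∫ x, (hitCount (U n) (T n) x : ℝ) ^ (2 * m) ∂μ ≤ (g n : ℝ) ^ (2 * m) * B :=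
    integral_hitCount_pow_le_of_separatedBy (hU n) hn (hT_le n) hgn (by positivity) hsepn
  calc ∑ s ∈ clusteredSets (g n) m (T n), μ.real (⋂ j ∈ s, U n j)
      ≤ (g n : ℝ) ^ (2 * m + 1) * ((T n).card * g n * ε n)
          + (∫ x, (hitCount (U n) (T n) x : ℝ) ^ (2 * m) ∂μ) / (g n : ℝ) ^ (2 * m + 1) :=
        sum_clusteredSets_measureReal_le (hU n) (by positivity) (hε₀ n) hεn
    _ ≤ (g n : ℝ) ^ (2 * m + 1) * (n * g n * ε n)
          + (g n : ℝ) ^ (2 * m) * B / (g n : ℝ) ^ (2 * m + 1) := by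
        have := hε₀ n
        have := hT_le n
        gcongr
    _ = (g n : ℝ) ^ (2 * m + 2) * (n * ε n) + B / g n := by
        field_simp
        ring

theorem tendsto_integral_choose_hitCount (hU : ∀ n j, MeasurableSet (U n j))
    (hg_top : Tendsto g atTop atTop) (hg : Tendsto (fun n => (g n : ℝ) / n) atTop (𝓝 0))
    (hT_le : ∀ n, (T n).card ≤ n) (hT : Tendsto (fun n => ((T n).card : ℝ) / n) atTop (𝓝 1))
    {Λ : ℕ → ℝ} (hsep : ∀ m, HasSeparatedAsymptotics μ U T g m (Λ m))
    {ε : ℕ → ℝ} (hε₀ : ∀ n, 0 ≤ ε n) (hε : ∀ᶠ n in atTop, ∀ i ∈ T n, ∀ l, 1 ≤ l → l < g n →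
      μ.real (U n i ∩ U n (i + l)) ≤ ε n)
    (hlim : ∀ q : ℕ, Tendsto (fun n : ℕ => (g n : ℝ) ^ q * (n * ε n)) atTop (𝓝 0)) (m : ℕ) :
    Tendsto (fun n => ∫ x, ((hitCount (U n) (T n) x).choose m : ℝ) ∂μ) atTop
      (𝓝 (Λ m / m.factorial)) := by
  have hsum := ((hsep m).tendsto_sum hg hT_le hT).add
    (tendsto_sum_clusteredSets (m := m) hU hg_top hT_le (hsep (2 * m)) hε₀ hε hlim)
  rw [add_zero] at hsum
  refine hsum.congr fun n => ?_
  rw [sum_separatedSets_add_sum_clusteredSets, integral_choose_hitCount (hU n)]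

end FactorialMoments

section Bonferroni

lemma abs_ite_sub_sum_choose_le (N k M : ℕ) :
    |(if N = k then (1 : ℝ) else 0)
      - ∑ t ∈ Finset.range M, (-1) ^ t * ((k + t).choose k * N.choose (k + t) : ℝ)|
      ≤ (k + M).choose k * N.choose (k + M) := by
  have hchoose (t : ℕ) : ((k + t).choose k * N.choose (k + t) : ℝ)
      = N.choose k * (N - k).choose t := by
    have h := Nat.choose_mul (n := N) (Nat.le_add_right k t)
    rw [Nat.add_sub_cancel_left] at h
    rw [mul_comm]
    exact_mod_cast h
  simp_rw [hchoose, mul_left_comm _ (N.choose k : ℝ), ← Finset.mul_sum]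
  rcases lt_trichotomy N k with h | rfl | h
  · simp [Nat.choose_eq_zero_of_lt h, h.ne]
  · cases M with
    | zero => simp
    | succ p => simp [Finset.sum_range_succ']
  · rw [if_neg h.ne']
    cases M with
    | zero => simp
    | succ p =>
      obtain ⟨d, hd⟩ : ∃ d, N - k = d + 1 := ⟨N - k - 1, by omega⟩
      have hsum : ∑ t ∈ Finset.range (p + 1), (-1 : ℝ) ^ t * ((d + 1).choose t : ℝ)
          = (-1) ^ p * d.choose p := by
        exact_mod_cast Int.alternating_sum_range_choose_eq_choose (n := d) (m := p)
      rw [hd, hsum, zero_sub, abs_neg, abs_mul, abs_mul, abs_neg_one_pow, one_mul, Nat.abs_cast,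
        Nat.abs_cast]
      gcongr
      rw [Nat.choose_succ_succ]
      exact Nat.le_add_right _ _

variable {Ω : Type*} [MeasurableSpace Ω] {μ : Measure Ω} [IsFiniteMeasure μ]

lemma abs_measureReal_eq_sub_sum_choose_le {N : Ω → ℕ} (hN : Measurable N)
    (hint : ∀ m, Integrable (fun x => ((N x).choose m : ℝ)) μ) (k M : ℕ) :
    |μ.real {x | N x = k} - ∑ t ∈ Finset.range M,
        (-1) ^ t * ((k + t).choose k * ∫ x, ((N x).choose (k + t) : ℝ) ∂μ)|
      ≤ (k + M).choose k * ∫ x, ((N x).choose (k + M) : ℝ) ∂μ := by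
  have hset : MeasurableSet {x | N x = k} := hN (measurableSet_singleton k)
  have hite : {x | N x = k}.indicator (1 : Ω → ℝ) = fun x => if N x = k then 1 else 0 := by
    ext x
    simp [Set.indicator_apply]
  have hint_ite : Integrable (fun x => if N x = k then (1 : ℝ) else 0) μ :=
    hite ▸ (integrable_const _).indicator hset
  have hint_term (t : ℕ) : Integrable
      (fun x => (-1) ^ t * ((k + t).choose k * (N x).choose (k + t) : ℝ)) μ :=
    ((hint (k + t)).const_mul _).const_mul _
  have hsum := integrable_finsetSum (Finset.range M) fun t _ => hint_term t
  calc _ = |∫ x, ((if N x = k then (1 : ℝ) else 0) - ∑ t ∈ Finset.range M,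
          (-1) ^ t * ((k + t).choose k * (N x).choose (k + t) : ℝ)) ∂μ| := by
        rw [integral_sub hint_ite hsum, ← hite, integral_indicator_one hset,
          integral_finsetSum _ fun t _ => hint_term t]
        simp_rw [integral_const_mul]
    _ ≤ ∫ x, |(if N x = k then (1 : ℝ) else 0) - ∑ t ∈ Finset.range M,
          (-1) ^ t * ((k + t).choose k * (N x).choose (k + t) : ℝ)| ∂μ :=
        abs_integral_le_integral_abs
    _ ≤ ∫ x, ((k + M).choose k * (N x).choose (k + M) : ℝ) ∂μ :=
        integral_mono (hint_ite.sub hsum).abs ((hint _).const_mul _)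
          fun x => abs_ite_sub_sum_choose_le _ _ _
    _ = _ := integral_const_mul _ _

lemma tendsto_of_abs_sub_le {ι : Type*} {l : Filter ι} {p : ι → ℝ} {a e : ℕ → ι → ℝ}
    {A E : ℕ → ℝ} {L : ℝ} (hpa : ∀ M n, |p n - a M n| ≤ e M n)
    (ha : ∀ M, Tendsto (a M) l (𝓝 (A M))) (he : ∀ M, Tendsto (e M) l (𝓝 (E M)))
    (hA : Tendsto A atTop (𝓝 L)) (hE : Tendsto E atTop (𝓝 0)) : Tendsto p l (𝓝 L) := by
  refine tendsto_order.2 ⟨fun c hc => ?_, fun c hc => ?_⟩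
  · obtain ⟨M, hM⟩ := ((hA.sub hE).eventually_const_lt (by rwa [sub_zero])).exists
    filter_upwards [((ha M).sub (he M)).eventually_const_lt hM] with n hn
    linarith [(abs_le.1 (hpa M n)).1]
  · obtain ⟨M, hM⟩ := ((hA.add hE).eventually_lt_const (by rwa [add_zero])).exists
    filter_upwards [((ha M).add (he M)).eventually_lt_const hM] with n hn
    linarith [(abs_le.1 (hpa M n)).2]

theorem tendsto_measureReal_eq_of_tendsto_integral_choose {N : ℕ → Ω → ℕ}
    (hN : ∀ n, Measurable (N n)) (hint : ∀ n m, Integrable (fun x => ((N n x).choose m : ℝ)) μ)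
    {Λ : ℕ → ℝ} (hΛ : ∀ m, Tendsto (fun n => ∫ x, ((N n x).choose m : ℝ) ∂μ) atTop (𝓝 (Λ m)))
    {k : ℕ} {p : ℝ} (hp : HasSum (fun t => (-1) ^ t * ((k + t).choose k * Λ (k + t))) p) :
    Tendsto (fun n => μ.real {x | N n x = k}) atTop (𝓝 p) := by
  refine tendsto_of_abs_sub_le
    (fun M n => abs_measureReal_eq_sub_sum_choose_le (hN n) (hint n) k M)
    (fun M => tendsto_finsetSum _ fun t _ => ((hΛ (k + t)).const_mul _).const_mul _)
    (fun M => (hΛ (k + M)).const_mul _) hp.tendsto_sum_nat ?_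
  rw [tendsto_zero_iff_norm_tendsto_zero]
  simpa [norm_mul] using hp.summable.tendsto_atTop_zero.norm

lemma hasSum_mixedPoisson {u : Ω → ℝ} (hu : AEStronglyMeasurable u μ) {K : ℝ}
    (huK : ∀ x, |u x| ≤ K) (k : ℕ) :
    HasSum (fun t => (-1) ^ t * ((k + t).choose k * ((∫ x, u x ^ (k + t) ∂μ) / (k + t).factorial)))
      (∫ x, u x ^ k / k.factorial * Real.exp (-u x) ∂μ) := by
  have hterm (t : ℕ) (x : Ω) : u x ^ k / k.factorial * ((-u x) ^ t / t.factorial)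
      = (-1) ^ t * ((k + t).choose k * (u x ^ (k + t) / (k + t).factorial)) := by
    rw [Nat.cast_add_choose, neg_pow, pow_add]
    field_simp
  have hsummable : Summable fun t : ℕ => K ^ k / k.factorial * (K ^ t / t.factorial) :=
    (Real.summable_pow_div_factorial K).mul_left _
  have hbound (t : ℕ) (x : Ω) : ‖u x ^ k / k.factorial * ((-u x) ^ t / t.factorial)‖
      ≤ K ^ k / k.factorial * (K ^ t / t.factorial) := by
    rw [norm_mul, norm_div, norm_div, norm_pow, norm_pow, norm_neg, RCLike.norm_natCast,
      RCLike.norm_natCast, Real.norm_eq_abs]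
    have := huK x
    have : 0 ≤ K := (abs_nonneg _).trans this
    gcongr
  have hexp (x : Ω) : HasSum (fun t : ℕ => u x ^ k / k.factorial * ((-u x) ^ t / t.factorial))
      (u x ^ k / k.factorial * Real.exp (-u x)) := by
    rw [Real.exp_eq_exp_ℝ]
    exact (NormedSpace.expSeries_div_hasSum_exp (-u x)).mul_left _
  have h := hasSum_integral_of_dominated_convergence (μ := μ) (fun t _ => _)
    (fun t => (by fun_prop : AEStronglyMeasurable
      (fun x => u x ^ k / k.factorial * ((-u x) ^ t / t.factorial)) μ))
    (fun t => ae_of_all _ (hbound t)) (ae_of_all _ fun _ => hsummable) (integrable_const _)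
    (ae_of_all _ hexp)
  refine h.congr_fun fun t => ?_
  simp_rw [hterm, integral_const_mul, integral_div]

end Bonferroni

section LogGap

/-- The least integer exceeding `(log n)²`: closer returns are handled by the short-return bound,
later ones by the decay of correlations. -/
noncomputable def logGap (n : ℕ) : ℕ := ⌊Real.log n ^ 2⌋₊ + 1

lemma logGap_pos (n : ℕ) : 0 < logGap n := Nat.succ_pos _

lemma sq_log_le_logGap (n : ℕ) : Real.log n ^ 2 ≤ logGap n := by
  rw [logGap, Nat.cast_succ]
  exact (Nat.lt_floor_add_one _).le

lemma natCast_le_sq_log_of_lt_logGap {n l : ℕ} (h : l < logGap n) : (l : ℝ) ≤ Real.log n ^ 2 :=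
  (Nat.le_floor_iff (by positivity)).1 (Nat.lt_succ_iff.1 h)

lemma tendsto_log_natCast_atTop : Tendsto (fun n : ℕ => Real.log n) atTop atTop :=
  Real.tendsto_log_atTop.comp tendsto_natCast_atTop_atTop

lemma tendsto_logGap_atTop : Tendsto logGap atTop atTop :=
  tendsto_natCast_atTop_iff.1 <| tendsto_atTop_mono sq_log_le_logGap <|
    (tendsto_pow_atTop two_ne_zero).comp tendsto_log_natCast_atTop

lemma tendsto_logGap_pow_mul_rpow_neg (q : ℕ) {s : ℝ} (hs : 0 < s) :
    Tendsto (fun n : ℕ => (logGap n : ℝ) ^ q * (n : ℝ) ^ (-s)) atTop (𝓝 0) := by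
  have hlog : Tendsto (fun n : ℕ => 2 ^ q * (Real.log n ^ (2 * q : ℝ) / (n : ℝ) ^ s)) atTop
      (𝓝 0) := by
    simpa using (((isLittleO_log_rpow_rpow_atTop (2 * q : ℝ) hs).tendsto_div_nhds_zero).comp
      tendsto_natCast_atTop_atTop).const_mul (2 ^ q)
  refine squeeze_zero' (Eventually.of_forall fun n => by positivity) ?_ hlog
  filter_upwards [tendsto_log_natCast_atTop.eventually_ge_atTop 1] with n hn
  have hgap : (logGap n : ℝ) ≤ 2 * Real.log n ^ 2 := by
    have hfloor := Nat.floor_le (by positivity : 0 ≤ Real.log n ^ 2)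
    rw [logGap, Nat.cast_succ]
    nlinarith
  have hpow : Real.log n ^ (2 * q : ℝ) = (Real.log n ^ 2) ^ q := by
    rw [← pow_mul]
    exact_mod_cast Real.rpow_natCast _ _
  rw [hpow, Real.rpow_neg (Nat.cast_nonneg n), ← div_eq_mul_inv, ← mul_div_assoc, ← mul_pow]
  gcongr

lemma tendsto_logGap_div : Tendsto (fun n => (logGap n : ℝ) / n) atTop (𝓝 0) := by
  simpa [Real.rpow_neg_one, div_eq_mul_inv] using tendsto_logGap_pow_mul_rpow_neg 1 one_pos

lemma tendsto_pow_mul_exp_neg_logGap {θ : ℝ} (hθ : 0 < θ) (q : ℕ) :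
    Tendsto (fun n : ℕ => (n : ℝ) ^ q * Real.exp (-θ * logGap n)) atTop (𝓝 0) := by
  have hlog : Tendsto (fun n : ℕ => Real.log n * (θ * Real.log n - q)) atTop atTop :=
    tendsto_log_natCast_atTop.atTop_mul_atTop₀ <|
      tendsto_atTop_add_const_right _ _ (tendsto_log_natCast_atTop.const_mul_atTop hθ)
  refine squeeze_zero' (Eventually.of_forall fun n => by positivity) ?_
    (Real.tendsto_exp_neg_atTop_nhds_zero.comp hlog)
  filter_upwards [eventually_gt_atTop 0] with n hn
  have hpow : (n : ℝ) ^ q = Real.exp (q * Real.log n) := by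
    rw [← Real.log_pow, Real.exp_log (by positivity)]
  rw [hpow, ← Real.exp_add, Function.comp_apply, Real.exp_le_exp]
  have := mul_le_mul_of_nonneg_left (sq_log_le_logGap n) hθ.le
  linarith [this, (by ring : Real.log n * (θ * Real.log n - q)
    = θ * Real.log n ^ 2 - q * Real.log n)]

end LogGap

section CloseReturns

variable {X : Set ℝ} {f : X → X} {μ : Measure X}

lemma measurableSet_closeReturnSet (hf : Measurable f) (j : ℕ) (r : ℝ) :
    MeasurableSet (closeReturnSet f j r) :=
  measurableSet_le (measurable_id.dist (hf.iterate j)) measurable_const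

lemma monotone_closeReturnSet (f : X → X) (j : ℕ) : Monotone (closeReturnSet f j) :=
  fun _ _ hrr' _ hx => le_trans hx hrr'

lemma closeReturnSet_inter_subset_preimage (f : X → X) (i l : ℕ) (r : ℝ) :
    closeReturnSet f i r ∩ closeReturnSet f (i + l) r ⊆ f^[i] ⁻¹' closeReturnSet f l (2 * r) := by
  rintro x ⟨hi : dist x (f^[i] x) ≤ r, hil : dist x (f^[i + l] x) ≤ r⟩
  rw [add_comm, Function.iterate_add_apply] at hil
  change dist (f^[i] x) (f^[l] (f^[i] x)) ≤ 2 * r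
  linarith [dist_triangle_left (f^[i] x) (f^[l] (f^[i] x)) x]

lemma recurrenceCount_eq_hitCount (f : X → X) (n : ℕ) (r : ℝ) (x : X) :
    recurrenceCount f n r x = hitCount (closeReturnSet f · r) (Finset.Icc 1 n) x := by
  simp only [recurrenceCount, hitCount, closeReturnSet, Set.mem_ofPred_eq, dist_comm x]

section Cells

variable {δ : ℝ}

lemma closeReturnSet_subset_mem_cellWindow (hδ : 0 < δ) (f : X → X) (j w : ℕ) :
    closeReturnSet f j (w * δ) ⊆ {x | f^[j] x ∈ cellWindow (cellIndex X δ) w (cellIndex X δ x)} :=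
  fun x hx => closedBall_subset_cellWindow hδ w x (Metric.mem_closedBall'.2 hx)

lemma mem_cellWindow_subset_closeReturnSet (hδ : 0 < δ) (f : X → X) (j w : ℕ) :
    {x | f^[j] x ∈ cellWindow (cellIndex X δ) w (cellIndex X δ x)}
      ⊆ closeReturnSet f j ((w + 1) * δ) :=
  fun x hx => Metric.mem_closedBall'.1 (cellWindow_subset_closedBall hδ w x hx)

variable [IsProbabilityMeasure μ] {g : ℕ} {η : ℝ}

lemma measureReal_biInter_closeReturnSet_le (hf : MeasurePreserving f μ μ) (hδ : 0 < δ)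
    (hη : 0 ≤ η) (hmix : ∀ a b : ℤ, DecorrelatesAfter f μ g η (cellIndex X δ ⁻¹' Set.Icc a b))
    {s : Finset ℕ} (hsep : SeparatedBy g s) (hs : ∀ j ∈ s, g ≤ j) (w : ℕ) :
    μ.real (⋂ j ∈ s, closeReturnSet f j (w * δ))
      ≤ ∫ x, μ.real (cellWindow (cellIndex X δ) w (cellIndex X δ x)) ^ s.card ∂μ
        + s.card * η * (2 * w + 1) := by
  have hcells := abs_measureReal_forall_mem_cellWindow_sub_integral_le hf measurable_cellIndex hη
    hmix hsep hs w
  refine (measureReal_mono fun x hx => ?_).trans (sub_le_iff_le_add'.1 (abs_le.1 hcells).2)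
  exact fun j hj => closeReturnSet_subset_mem_cellWindow hδ f j w (Set.mem_iInter₂.1 hx j hj)

lemma integral_cellWindow_pow_sub_le_measureReal_biInter_closeReturnSet
    (hf : MeasurePreserving f μ μ) (hδ : 0 < δ) (hη : 0 ≤ η)
    (hmix : ∀ a b : ℤ, DecorrelatesAfter f μ g η (cellIndex X δ ⁻¹' Set.Icc a b))
    {s : Finset ℕ} (hsep : SeparatedBy g s) (hs : ∀ j ∈ s, g ≤ j) (w : ℕ) :
    ∫ x, μ.real (cellWindow (cellIndex X δ) w (cellIndex X δ x)) ^ s.card ∂μ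
        - s.card * η * (2 * w + 1)
      ≤ μ.real (⋂ j ∈ s, closeReturnSet f j ((w + 1) * δ)) := by
  have hcells := abs_measureReal_forall_mem_cellWindow_sub_integral_le hf measurable_cellIndex hη
    hmix hsep hs w
  refine le_trans (sub_le_of_abs_sub_le_left hcells) (measureReal_mono fun x hx => ?_)
  exact Set.mem_iInter₂.2 fun j hj => mem_cellWindow_subset_closeReturnSet hδ f j w (hx j hj)

lemma measureReal_closeReturnSet_inter_le (hf : Measurable f) (hδ : 0 < δ)
    (hmix : ∀ a b : ℤ, DecorrelatesAfter f μ g η (cellIndex X δ ⁻¹' Set.Icc a b)) {P : ℝ}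
    (hP : ∀ a : ℤ, μ.real (cellIndex X δ ⁻¹' {a}) ≤ P) {i : ℕ} (hi : g ≤ i) (l w : ℕ) :
    μ.real (closeReturnSet f i (w * δ) ∩ closeReturnSet f (i + l) (w * δ))
      ≤ (P + η) * ((2 * w + 1) * μ.real (closeReturnSet f l (2 * (w * δ)))) := by
  refine (measureReal_mono fun x hx => ?_).trans (measureReal_mem_cellWindow_inter_le
    measurable_cellIndex (fun a => by simpa using hmix a a) hP hi w
    (measurableSet_closeReturnSet hf l _))
  exact ⟨closeReturnSet_subset_mem_cellWindow hδ f i w hx.1,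
    closeReturnSet_inter_subset_preimage f i l _ hx⟩

end Cells

end CloseReturns

/-- The size of the cells that discretise the returns up to time `n`; the return radius `τ / (2n)`
consists of `n` cells. -/
noncomputable def cellSize (τ : ℝ) (n : ℕ) : ℝ := τ / (2 * (n : ℝ) ^ 2)

section SeparatedReturns

variable {X : Set ℝ} {f : X → X} {μ : Measure X} {ρ : X → ℝ} {K : NNReal} {τ : ℝ}

lemma cellSize_pos (hτ : 0 < τ) {n : ℕ} (hn : 0 < n) : 0 < cellSize τ n := by
  rw [cellSize]
  positivity

lemma natCast_mul_cellSize (τ : ℝ) (n : ℕ) : n * cellSize τ n = τ / (2 * n) := by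
  rcases n.eq_zero_or_pos with rfl | hn
  · simp
  · rw [cellSize]
    field_simp

lemma tendsto_natCast_succ_sub_div {g : ℕ → ℕ} (hg : Tendsto (fun n => (g n : ℝ) / n) atTop (𝓝 0)) :
    Tendsto (fun n => ((n + 1 - g n : ℕ) : ℝ) / n) atTop (𝓝 1) := by
  have hlower : Tendsto (fun n => 1 - (g n : ℝ) / n) atTop (𝓝 1) := by simpa using hg.const_sub 1
  have hupper : Tendsto (fun n : ℕ => 1 + 1 / (n : ℝ)) atTop (𝓝 1) := by
    simpa using tendsto_one_div_atTop_nhds_zero_nat.const_add (1 : ℝ)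
  refine tendsto_of_tendsto_of_tendsto_of_le_of_le' hlower hupper ?_ ?_ <;>
    filter_upwards [eventually_ne_atTop 0] with n hn
  · rw [one_sub_div (Nat.cast_ne_zero.2 hn)]
    gcongr
    rw [sub_le_iff_le_add]
    exact_mod_cast (by omega : n ≤ n + 1 - g n + g n)
  · rw [one_add_div (Nat.cast_ne_zero.2 hn)]
    gcongr
    exact_mod_cast Nat.sub_le _ _

lemma tendsto_pow_mul_mul_two_mul_add_one {η : ℕ → ℝ}
    (hη : ∀ q : ℕ, Tendsto (fun n : ℕ => (n : ℝ) ^ q * η n) atTop (𝓝 0)) (m : ℕ) (c : ℝ) :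
    Tendsto (fun n : ℕ => (n : ℝ) ^ m * (c * η n * (2 * n + 1))) atTop (𝓝 0) := by
  have hsum := ((hη (m + 1)).const_mul (2 * c)).add ((hη m).const_mul c)
  simp only [mul_zero, add_zero] at hsum
  exact hsum.congr fun n => by ring

variable [IsProbabilityMeasure μ]

lemma IsLebesgueDensity.tendsto_integral_mul_measureReal_cellWindow_cellSize_pow
    (hX : MeasurableSet X) (h : IsLebesgueDensity μ ρ) (hK : ∀ x, ρ x ≤ K) (hτ : 0 < τ)
    {w : ℕ → ℕ} (hw : Tendsto (fun n => (w n : ℝ) / n) atTop (𝓝 1)) (m : ℕ) :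
    Tendsto (fun n : ℕ => (n : ℝ) ^ m * ∫ x, μ.real
        (cellWindow (cellIndex X (cellSize τ n)) (w n) (cellIndex X (cellSize τ n) x)) ^ m ∂μ)
      atTop (𝓝 (∫ x, (τ * ρ x) ^ m ∂μ)) := by
  refine h.tendsto_integral_mul_measureReal_cellWindow_pow hX hK hτ
    ((eventually_gt_atTop 0).mono fun n hn => cellSize_pos hτ hn) ?_ ?_ m
  · simpa only [natCast_mul_cellSize, ← div_div] using tendsto_const_div_atTop_nhds_zero_nat (τ / 2)
  · have hscale : Tendsto (fun n => τ * ((w n : ℝ) / n)) atTop (𝓝 τ) := by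
      simpa using hw.const_mul τ
    refine hscale.congr fun n => ?_
    calc τ * ((w n : ℝ) / n) = 2 * w n * (τ / (2 * n)) := by ring
      _ = n * (2 * (w n * cellSize τ n)) := by rw [← natCast_mul_cellSize]; ring

lemma hasSeparatedAsymptotics_closeReturnSet (hX : MeasurableSet X) (hf : MeasurePreserving f μ μ)
    (hρ : IsLebesgueDensity μ ρ) (hK : ∀ x, ρ x ≤ K) (hτ : 0 < τ) {g : ℕ → ℕ} {η : ℕ → ℝ}
    (hη₀ : ∀ n, 0 ≤ η n) (hη : ∀ q : ℕ, Tendsto (fun n : ℕ => (n : ℝ) ^ q * η n) atTop (𝓝 0))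
    (hmix : ∀ (n : ℕ) (δ : ℝ), 0 < δ → ∀ a b : ℤ,
      DecorrelatesAfter f μ (g n) (η n) (cellIndex X δ ⁻¹' Set.Icc a b))
    {T : ℕ → Finset ℕ} (hT : ∀ n, ∀ j ∈ T n, g n ≤ j) (m : ℕ) :
    HasSeparatedAsymptotics μ (fun n j => closeReturnSet f j (τ / (2 * n))) T g m
      (∫ x, (τ * ρ x) ^ m ∂μ) := by
  set I : ℕ → ℕ → ℝ := fun n w => ∫ x,
    μ.real (cellWindow (cellIndex X (cellSize τ n)) w (cellIndex X (cellSize τ n) x)) ^ m ∂μ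
  set err : ℕ → ℝ := fun n => m * η n * (2 * n + 1)
  have herr : Tendsto (fun n : ℕ => (n : ℝ) ^ m * err n) atTop (𝓝 0) :=
    tendsto_pow_mul_mul_two_mul_add_one hη m m
  have hlower : Tendsto (fun n : ℕ => (n : ℝ) ^ m * I n (n - 1) - (n : ℝ) ^ m * err n) atTop
      (𝓝 (∫ x, (τ * ρ x) ^ m ∂μ)) := by
    simpa using (hρ.tendsto_integral_mul_measureReal_cellWindow_cellSize_pow hX hK hτ
      (w := fun n => n - 1) (tendsto_natCast_succ_sub_div (g := fun _ => 2)
        (tendsto_const_div_atTop_nhds_zero_nat _)) m).sub herr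
  have hupper : Tendsto (fun n : ℕ => (n : ℝ) ^ m * I n n + (n : ℝ) ^ m * err n) atTop
      (𝓝 (∫ x, (τ * ρ x) ^ m ∂μ)) := by
    simpa using (hρ.tendsto_integral_mul_measureReal_cellWindow_cellSize_pow hX hK hτ
      (w := fun n => n) (tendsto_natCast_succ_sub_div (g := fun _ => 1)
        (tendsto_const_div_atTop_nhds_zero_nat _)) m).add herr
  intro ε hε
  filter_upwards [hlower.eventually_const_le (sub_lt_self _ hε),
    hupper.eventually_le_const (lt_add_of_pos_right _ hε), eventually_gt_atTop 0]
    with n hlow hup hn s hs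
  obtain ⟨⟨hsT, rfl⟩, hsep⟩ := mem_separatedSets.1 hs
  have hδ := cellSize_pos hτ hn
  have hsg : ∀ j ∈ s, g n ≤ j := fun j hj => hT n j (hsT hj)
  have hle := measureReal_biInter_closeReturnSet_le hf hδ (hη₀ n) (hmix n _ hδ) hsep hsg n
  have hge := integral_cellWindow_pow_sub_le_measureReal_biInter_closeReturnSet hf hδ (hη₀ n)
    (hmix n _ hδ) hsep hsg (n - 1)
  rw [natCast_mul_cellSize] at hle
  rw [Nat.cast_pred hn, sub_add_cancel, natCast_mul_cellSize] at hge
  have herr_le : s.card * η n * (2 * ((n : ℝ) - 1) + 1) ≤ err n := by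
    have := hη₀ n
    simp only [err]
    gcongr
    linarith
  rw [← mul_sub] at hlow
  rw [← mul_add] at hup
  rw [abs_sub_le_iff, sub_le_iff_le_add', sub_le_comm]
  exact ⟨(mul_le_mul_of_nonneg_left hle (by positivity)).trans hup,
    hlow.trans (mul_le_mul_of_nonneg_left (by linarith [hge]) (by positivity))⟩

end SeparatedReturns

section LateReturns

variable {X : Set ℝ} {f : X → X} {μ : Measure X} {ρ : X → ℝ} {K : NNReal} {τ β C : ℝ}

lemma tendsto_card_Icc_logGap_div :
    Tendsto (fun n => ((Finset.Icc (logGap n) n).card : ℝ) / n) atTop (𝓝 1) := by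
  simp only [Nat.card_Icc]
  exact tendsto_natCast_succ_sub_div tendsto_logGap_div

lemma tendsto_logGap_pow_mul_closePairBound {η : ℕ → ℝ}
    (hη : ∀ q : ℕ, Tendsto (fun n : ℕ => (n : ℝ) ^ q * η n) atTop (𝓝 0)) (K τ C : ℝ) (hβ : 0 < β)
    (q : ℕ) :
    Tendsto (fun n : ℕ => (logGap n : ℝ) ^ q * (n * ((K * (2 * cellSize τ n) + η n) *
      ((2 * n + 1) * (C * (n : ℝ) ^ (-β)))))) atTop (𝓝 0) := by
  have hcells : Tendsto (fun n : ℕ => K * τ * (2 + 1 / (n : ℝ))) atTop (𝓝 (K * τ * (2 + 0))) :=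
    (tendsto_one_div_atTop_nhds_zero_nat.const_add 2).const_mul (K * τ)
  have hrate : Tendsto (fun n : ℕ => K * τ * (2 + 1 / (n : ℝ)) +
      (2 * ((n : ℝ) ^ 2 * η n) + (n : ℝ) ^ 1 * η n)) atTop
      (𝓝 (K * τ * (2 + 0) + (2 * 0 + 0))) :=
    hcells.add (((hη 2).const_mul 2).add (hη 1))
  have hprod := ((tendsto_logGap_pow_mul_rpow_neg q hβ).mul hrate).mul_const C
  rw [zero_mul, zero_mul] at hprod
  refine hprod.congr' ?_
  filter_upwards [eventually_ne_atTop 0] with n hn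
  rw [cellSize]
  field_simp

variable [IsProbabilityMeasure μ]

lemma tendsto_integral_choose_hitCount_closeReturnSet (hX : MeasurableSet X)
    (hf : MeasurePreserving f μ μ) (hρ : IsLebesgueDensity μ ρ) (hK : ∀ x, ρ x ≤ K)
    (hdec : HasExponentialDecay f μ) (hτ : 0 < τ) (hβ : 0 < β)
    (hshort : ∀ᶠ n : ℕ in atTop, ∀ j : ℕ, 1 ≤ j → (j : ℝ) ≤ Real.log n ^ 2 →
      μ.real (closeReturnSet f j (τ / n)) ≤ C * (n : ℝ) ^ (-β)) (m : ℕ) :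
    Tendsto (fun n : ℕ => ∫ x, ((hitCount (closeReturnSet f · (τ / (2 * n)))
      (Finset.Icc (logGap n) n) x).choose m : ℝ) ∂μ) atTop
      (𝓝 ((∫ x, (τ * ρ x) ^ m ∂μ) / m.factorial)) := by
  obtain ⟨D, hD, θ, hθ, hmix⟩ := hdec.exists_decorrelatesAfter hf.measurable
  set η : ℕ → ℝ := fun n => D * Real.exp (-θ * logGap n)
  have hη₀ : ∀ n, 0 ≤ η n := fun n => by positivity
  have hη (q : ℕ) : Tendsto (fun n : ℕ => (n : ℝ) ^ q * η n) atTop (𝓝 0) := by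
    simpa [η, mul_left_comm] using (tendsto_pow_mul_exp_neg_logGap hθ q).const_mul D
  have hmix_cells (n : ℕ) (δ : ℝ) (hδ : 0 < δ) (a b : ℤ) :
      DecorrelatesAfter f μ (logGap n) (η n) (cellIndex X δ ⁻¹' Set.Icc a b) :=
    hmix _ _ (measurable_cellIndex measurableSet_Icc)
      (Set.ordConnected_Icc.preimage_mono (monotone_cellIndex hδ.le))
  refine tendsto_integral_choose_hitCount (T := fun n => Finset.Icc (logGap n) n)
    (Λ := fun m => ∫ x, (τ * ρ x) ^ m ∂μ)
    (ε := fun n => (K * (2 * cellSize τ n) + η n) * ((2 * n + 1) * (|C| * (n : ℝ) ^ (-β))))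
    (fun n j => measurableSet_closeReturnSet hf.measurable j _) tendsto_logGap_atTop
    tendsto_logGap_div (fun n => ?_) tendsto_card_Icc_logGap_div
    (hasSeparatedAsymptotics_closeReturnSet hX hf hρ hK hτ hη₀ hη hmix_cells
      fun n j hj => (Finset.mem_Icc.1 hj).1) (fun n => ?_) ?_
    (tendsto_logGap_pow_mul_closePairBound hη K τ |C| hβ) m
  · rw [Nat.card_Icc]
    have := logGap_pos n
    omega
  · have := hη₀ n
    rw [cellSize]
    positivity
  · filter_upwards [hshort, eventually_gt_atTop 0] with n hn hn₀ i hi l hl hlg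
    have hδ := cellSize_pos hτ hn₀
    have hpair := measureReal_closeReturnSet_inter_le hf.measurable hδ (hmix_cells n _ hδ)
      (hρ.measureReal_cell_le hX hK hδ) (Finset.mem_Icc.1 hi).1 l n
    have hradius : 2 * (τ / (2 * n)) = τ / n := by field_simp
    rw [natCast_mul_cellSize, hradius] at hpair
    refine hpair.trans ?_
    have := hη₀ n
    gcongr
    exact (hn l hl (natCast_le_sq_log_of_lt_logGap hlg)).trans (by gcongr; exact le_abs_self C)

end LateReturns

section EarlyReturns

lemma abs_measureReal_sub_le_of_forall_notMem {Ω : Type*} [MeasurableSpace Ω] {μ : Measure Ω}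
    [IsFiniteMeasure μ] {A B D : Set Ω} (hA : MeasurableSet A) (hB : MeasurableSet B)
    (h : ∀ x ∉ D, x ∈ A ↔ x ∈ B) : |μ.real A - μ.real B| ≤ μ.real D := by
  refine (abs_measureReal_sub_le_measureReal_symmDiff hA.nullMeasurableSet
    hB.nullMeasurableSet).trans (measureReal_mono fun x hx => ?_)
  by_contra hxD
  simp [Set.mem_symmDiff, h x hxD] at hx

lemma hitCount_Icc_eq_of_notMem {Ω : Type*} {U : ℕ → Set Ω} {g n : ℕ} (hg : 1 ≤ g) {x : Ω}
    (hx : x ∉ ⋃ j ∈ Finset.Ico 1 g, U j) :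
    hitCount U (Finset.Icc 1 n) x = hitCount U (Finset.Icc g n) x := by
  classical
  rw [hitCount, hitCount]
  congr 1
  ext j
  have hj : x ∈ U j → ¬ (1 ≤ j ∧ j < g) := fun hxj hj =>
    hx (Set.mem_biUnion (Finset.mem_Ico.2 hj) hxj)
  simp only [Finset.mem_filter, Finset.mem_Icc]
  grind

variable {X : Set ℝ} {f : X → X} {μ : Measure X} [IsFiniteMeasure μ] {τ β C : ℝ}

lemma tendsto_measureReal_biUnion_closeReturnSet (hτ : 0 < τ) (hβ : 0 < β)
    (hshort : ∀ᶠ n : ℕ in atTop, ∀ j : ℕ, 1 ≤ j → (j : ℝ) ≤ Real.log n ^ 2 →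
      μ.real (closeReturnSet f j (τ / n)) ≤ C * (n : ℝ) ^ (-β)) :
    Tendsto (fun n : ℕ => μ.real (⋃ j ∈ Finset.Ico 1 (logGap n), closeReturnSet f j (τ / (2 * n))))
      atTop (𝓝 0) := by
  have hlim : Tendsto (fun n : ℕ => (logGap n : ℝ) ^ 1 * (n : ℝ) ^ (-β) * |C|) atTop (𝓝 0) := by
    simpa using (tendsto_logGap_pow_mul_rpow_neg 1 hβ).mul_const |C|
  refine squeeze_zero' (Eventually.of_forall fun n => measureReal_nonneg) ?_ hlim
  filter_upwards [hshort] with n hn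
  have hradius : τ / (2 * n) ≤ τ / n := by
    rw [mul_comm, ← div_div]
    exact half_le_self (by positivity)
  have hj (j : ℕ) (hj : j ∈ Finset.Ico 1 (logGap n)) :
      μ.real (closeReturnSet f j (τ / (2 * n))) ≤ |C| * (n : ℝ) ^ (-β) := by
    obtain ⟨hj₁, hjg⟩ := Finset.mem_Ico.1 hj
    calc μ.real (closeReturnSet f j (τ / (2 * n))) ≤ μ.real (closeReturnSet f j (τ / n)) :=
          measureReal_mono (monotone_closeReturnSet f j hradius)
      _ ≤ C * (n : ℝ) ^ (-β) := hn j hj₁ (natCast_le_sq_log_of_lt_logGap hjg)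
      _ ≤ |C| * (n : ℝ) ^ (-β) := by gcongr; exact le_abs_self C
  calc μ.real (⋃ j ∈ Finset.Ico 1 (logGap n), closeReturnSet f j (τ / (2 * n)))
      ≤ ∑ j ∈ Finset.Ico 1 (logGap n), μ.real (closeReturnSet f j (τ / (2 * n))) :=
        measureReal_biUnion_finset_le _ _
    _ ≤ (Finset.Ico 1 (logGap n)).card • (|C| * (n : ℝ) ^ (-β)) := Finset.sum_le_card_nsmul _ _ _ hj
    _ ≤ logGap n * (|C| * (n : ℝ) ^ (-β)) := by
        rw [Nat.card_Ico, nsmul_eq_mul]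
        gcongr
        exact Nat.sub_le _ _
    _ = (logGap n : ℝ) ^ 1 * (n : ℝ) ^ (-β) * |C| := by ring

end EarlyReturns

lemma ShortReturnBound.exists_forall_closeReturnSet_le {X : Set ℝ} {f : X → X} {μ : Measure X}
    (h : ShortReturnBound f μ) {τ : ℝ} (hτ : 0 < τ) :
    ∃ β : ℝ, 0 < β ∧ ∃ C : ℝ, ∀ᶠ n : ℕ in atTop, ∀ j : ℕ, 1 ≤ j → (j : ℝ) ≤ Real.log n ^ 2 →
      μ.real (closeReturnSet f j (τ / n)) ≤ C * (n : ℝ) ^ (-β) := by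
  have hcomparable : SeqComparable (fun n => τ / n) fun n => (n : ℝ) ^ (-1 : ℝ) := by
    refine ⟨max τ τ⁻¹ + 1, by linarith [lt_max_of_lt_left (c := τ⁻¹) hτ], ?_⟩
    filter_upwards [eventually_ne_atTop 0] with n hn
    rw [Real.rpow_neg_one, div_inv_eq_mul, div_mul_cancel₀ _ (Nat.cast_ne_zero.2 hn)]
    refine ⟨inv_le_of_inv_le₀ hτ ?_, ?_⟩ <;> linarith [le_max_left τ τ⁻¹, le_max_right τ τ⁻¹]
  obtain ⟨β, hβ, C, -, hshort⟩ := h 1 _ one_pos hcomparable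
  refine ⟨β, hβ.1, C * τ ^ β, hshort.mono fun n hn j hj hjn => (hn j hj hjn).trans_eq ?_⟩
  rw [Real.div_rpow hτ.le n.cast_nonneg, Real.rpow_neg n.cast_nonneg]
  ring

theorem mainTheorem1_general {X : Set ℝ} (hX : MeasurableSet X) {f : X → X} {μ : Measure X}
    [IsProbabilityMeasure μ] (hf : MeasurePreserving f μ μ) {ρ : X → ℝ}
    (hρ : IsLebesgueDensity μ ρ) {K : NNReal} (hK : ∀ x, ρ x ≤ K) (hdec : HasExponentialDecay f μ)
    {τ : ℝ} (hτ : 0 < τ) {β : ℝ} (hβ : 0 < β) {C : ℝ}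
    (hshort : ∀ᶠ n : ℕ in atTop, ∀ j : ℕ, 1 ≤ j → (j : ℝ) ≤ Real.log n ^ 2 →
      μ.real (closeReturnSet f j (τ / n)) ≤ C * (n : ℝ) ^ (-β)) (k : ℕ) :
    Tendsto (fun n : ℕ => μ.real {x | recurrenceCount f n (τ / (2 * n)) x = k}) atTop
      (𝓝 (∫ x, τ ^ k * ρ x ^ (k + 1) / (k.factorial : ℝ) * Real.exp (-(ρ x * τ))
        ∂lebesgueOn X)) := by
  set U : ℕ → ℕ → Set X := fun n j => closeReturnSet f j (τ / (2 * n))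
  have hU (n j : ℕ) : MeasurableSet (U n j) := measurableSet_closeReturnSet hf.measurable j _
  have hbound (x : X) : |τ * ρ x| ≤ τ * K := by
    rw [abs_of_nonneg (mul_nonneg hτ.le (hρ.nonneg x))]
    exact mul_le_mul_of_nonneg_left (hK x) hτ.le
  have hlate := tendsto_measureReal_eq_of_tendsto_integral_choose
    (fun n => measurable_hitCount (hU n) (Finset.Icc (logGap n) n))
    (fun n m => integrable_comp_hitCount (hU n) _ fun N => (N.choose m : ℝ))
    (tendsto_integral_choose_hitCount_closeReturnSet hX hf hρ hK hdec hτ hβ hshort)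
    (hasSum_mixedPoisson (hρ.measurable.const_mul τ).aestronglyMeasurable hbound k)
  have hdiff : Tendsto (fun n : ℕ => μ.real {x | hitCount (U n) (Finset.Icc 1 n) x = k}
      - μ.real {x | hitCount (U n) (Finset.Icc (logGap n) n) x = k}) atTop (𝓝 0) :=
    squeeze_zero_norm (fun n => abs_measureReal_sub_le_of_forall_notMem
      (measurable_hitCount (hU n) _ (measurableSet_singleton k))
      (measurable_hitCount (hU n) _ (measurableSet_singleton k)) fun x hx => by
        rw [Set.mem_ofPred_eq, Set.mem_ofPred_eq,
          hitCount_Icc_eq_of_notMem (U := U n) (logGap_pos n) hx])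
      (tendsto_measureReal_biUnion_closeReturnSet hτ hβ hshort)
  have hcount := hdiff.add hlate
  simp only [sub_add_cancel, zero_add, U, ← recurrenceCount_eq_hitCount, hρ.integral_eq] at hcount
  convert hcount using 4 with x
  ring_nf

theorem mainTheorem1 (X : Set ℝ) (hX : MeasurableSet X) (f : X → X) (μ : Measure X) (ρ : X → ℝ)
    (hf : HyperbolicRecurrent f μ ρ) (τ : ℝ) (hτ : 0 < τ) (k : ℕ) (hk : 1 ≤ k) :
    Tendsto (fun n : ℕ => μ.real {x | recurrenceCount f n (τ / (2 * n)) x = k}) atTop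
      (𝓝 (∫ x, τ ^ k * ρ x ^ (k + 1) / (k.factorial : ℝ) * Real.exp (-(ρ x * τ)) ∂lebesgueOn X)) := by
  have := hf.isProbabilityMeasure
  obtain ⟨K, hK⟩ := hf.density_bv.exists_le
  obtain ⟨β, hβ, C, hshort⟩ := hf.shortReturns.exists_forall_closeReturnSet_le hτ
  exact mainTheorem1_general hX hf.ergodic.toMeasurePreserving hf.density hK hf.decay hτ hβ hshort k
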